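/- Let $\mathbf{C}$ and $\mathbf{D}$ be varieties of algebras, each given by a small set of operation symbols ($\Omega_{\mathbf{C}}$, resp. $\Omega_{\mathbf{D}}$), with possibly infinite arities, and by a small set of identities; the empty algebra is allowed when there are no zeroary operations. Fix regular infinite cardinals $\lambda_{\mathbf{C}}$ and $\lambda_{\mathbf{D}}$ such that $\lambda_{\mathbf{C}}$ is greater than every arity of an operation symbol of $\mathbf{C}$ and than the number of indeterminates in each defining identity of $\mathbf{C}$, and likewise $\lambda_{\mathbf{D}}$ for $\mathbf{D}$. A $\mathbf{D}$-coalgebra $R$ in $\mathbf{C}$ is an object $|R|$ of $\mathbf{C}$ with a morphism $\alpha^R:|R|\to\coprod_{\mathrm{ari}(\alpha)}|R|$ for each $\alpha\in\Omega_{\mathbf{D}}$, such that for every object $A$ of $\mathbf{C}$ the operations which these morphisms induce on the set $\mathbf{C}(|R|,A)$ satisfy the identities of $\mathbf{D}$. A morphism of coalgebras $R\to S$ is a morphism $|R|\to|S|$ in $\mathbf{C}$ that makes commuting squares with the co-operations. Write $\mathrm{Coalg}(\mathbf{C},\mathbf{D})$ for the category of these coalgebras, $\|R\|$ for the underlying set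 of $|R|$, and $\mathrm{Rep}(\mathbf{C},\mathbf{D})$ for the full subcategory of the category of functors $\mathbf{C}\to\mathbf{D}$ consisting of those whose composite with the underlying set functor of $\mathbf{D}$ is representable. For a cardinal $\kappa\ge 1$ and an infinite cardinal $\lambda$, let $\kappa^{\lambda-}$ denote the least cardinal $\mu\ge\kappa$ such that $\mu^{\iota}=\mu$ for all cardinals $\iota$ with $0<\iota<\lambda$. **Theorem.** The category $\mathrm{Coalg}(\mathbf{C},\mathbf{D})$ has all small limits. Equivalently, since $R\mapsto\mathbf{C}(R,-)$ gives an equivalence $\mathrm{Coalg}(\mathbf{C},\mathbf{D})^{\mathrm{op}}\simeq\mathrm{Rep}(\mathbf{C},\mathbf{D})$, the category $\mathrm{Rep}(\mathbf{C},\mathbf{D})$ has all small colimits; in particular, it has an initial object. Moreover, for every small category $\mathbf{E}$ and every functor $F:\mathbf{E}\to\mathrm{Coalg}(\mathbf{C},\mathbf{D})$, $$\mathrm{card}\bigl(\|\varprojlim F\|\bigr)\ \le\ \max\bigl(\mathrm{card}(\varprojlim_{E\in\mathbf{E}}\|F(E)\|),\,\lambda_{\mathbf{D}}\bigr)^{\max(\mathrm{card}(\Omega_{\mathbf{C}}),\,\mathrm{card}(\Omega_{\mathbf{D}}),\,2)^{\lambda_{\mathbf{C}}-}},$$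 where the limit on the right-hand side is taken in the category of sets. -/

import Mathlib

open CategoryTheory CategoryTheory.Limits

universe u v

namespace UnivAlg

/-- Terms over the operation symbols `Op` (the symbol `α` having arity `Ar α`) in the
indeterminates `X`: the free algebra of this type on `X`. -/
inductive AlgTerm {Op : Type u} (Ar : Op → Type u) (X : Type u) : Type u
  | var : X → AlgTerm Ar X
  | op : (α : Op) → (Ar α → AlgTerm Ar X) → AlgTerm Ar X

/-- The value of a term in an algebra with operations `o`, under the assignment `x`; this is the
homomorphism from the term algebra that extends `x`. -/
def AlgTerm.eval {Op : Type u} {Ar : Op → Type u} {K : Type u} {X : Type v}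
    (o : (α : Op) → (Ar α → X) → X) (x : K → X) : AlgTerm Ar K → X
  | .var k => x k
  | .op α t => o α fun i => (t i).eval o x

/-- A variety of (possibly infinitary) algebras, given by a small set of operation symbols with
their arities, a small set of identities, and a fixed regular cardinal `lam` that exceeds all
arities and the number of indeterminates of each identity. Arities are given as index sets
instead of cardinals. -/
structure Variety : Type (u + 1) where
  /-- the operation symbols -/
  Op : Type u
  /-- the arity of an operation symbol, as an index set -/
  Ar : Op → Type u
  /-- the chosen regular infinite cardinal -/
  lam : Cardinal.{u}
  lam_regular : lam.IsRegular
  ar_lt : ∀ α, Cardinal.mk (Ar α) < lam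
  /-- the index set of the defining identities -/
  Eqn : Type u
  /-- the indeterminates of an identity -/
  Vars : Eqn → Type u
  vars_lt : ∀ e, Cardinal.mk (Vars e) < lam
  /-- the left-hand side of an identity -/
  lhs : (e : Eqn) → AlgTerm Ar (Vars e)
  /-- the right-hand side of an identity -/
  rhs : (e : Eqn) → AlgTerm Ar (Vars e)

/-- A system of operations satisfies all the defining identities of the variety. -/
def Variety.Satisfies (V : Variety.{u}) {X : Type v} (o : (α : V.Op) → (V.Ar α → X) → X) : Prop :=
  ∀ (e : V.Eqn) (x : V.Vars e → X), (V.lhs e).eval o x = (V.rhs e).eval o x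

/-- The algebras of a variety (the empty algebra is allowed if there are no zeroary operations). -/
structure Alg (V : Variety.{u}) : Type (u + 1) where
  /-- the underlying set -/
  carrier : Type u
  /-- the operations -/
  op : (α : V.Op) → (V.Ar α → carrier) → carrier
  sat : V.Satisfies op

namespace Alg

variable {V : Variety.{u}}

/-- Homomorphisms of algebras. -/
@[ext]
structure Hom (A B : Alg V) : Type u where
  /-- the underlying map -/
  toFun : A.carrier → B.carrier
  map_op : ∀ (α : V.Op) (x : V.Ar α → A.carrier),
    toFun (A.op α x) = B.op α fun i => toFun (x i)

instance : Category (Alg V) where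
  Hom A B := Hom A B
  id A := ⟨fun a => a, fun _ _ => rfl⟩
  comp f g := ⟨fun a => g.toFun (f.toFun a), fun α x => by rw [f.map_op, g.map_op]⟩

@[ext]
theorem hom_ext {A B : Alg V} {f g : A ⟶ B} (h : ∀ a, f.toFun a = g.toFun a) : f = g :=
  Hom.ext (funext h)

@[simp] theorem id_toFun (A : Alg V) (a : A.carrier) : (𝟙 A : A ⟶ A).toFun a = a := rfl

@[simp] theorem comp_toFun {A B C : Alg V} (f : A ⟶ B) (g : B ⟶ C) (a : A.carrier) :
    (f ≫ g).toFun a = g.toFun (f.toFun a) := rfl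

/-- The underlying set functor. -/
def forget (V : Variety.{u}) : Alg V ⥤ Type u where
  obj A := A.carrier
  map f := TypeCat.ofHom f.toFun

end Alg

/-! ### Varieties have small coproducts -/

section Coproducts

theorem AlgTerm.map_eval {Op : Type u} {Ar : Op → Type u} {K : Type u} {X Y : Type v}
    {o : (α : Op) → (Ar α → X) → X} {o' : (α : Op) → (Ar α → Y) → Y} (h : X → Y)
    (hh : ∀ α x, h (o α x) = o' α fun i => h (x i)) (x : K → X) (t : AlgTerm Ar K) :
    h (t.eval o x) = t.eval o' fun k => h (x k) := by
  induction t with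
  | var k => rfl
  | op α t ih =>
    simp only [AlgTerm.eval, hh]
    congr 1
    funext i
    exact ih i

variable {V : Variety.{u}} {J : Type u} (A : J → Alg V)

/-- The congruence on the terms in the disjoint union of the `A j` whose quotient is the
coproduct of the `A j`. -/
inductive CoprodRel : AlgTerm V.Ar (Σ j, (A j).carrier) → AlgTerm V.Ar (Σ j, (A j).carrier) → Prop
  | refl (s) : CoprodRel s s
  | symm {s t} : CoprodRel s t → CoprodRel t s
  | trans {s t r} : CoprodRel s t → CoprodRel t r → CoprodRel s r
  | congr (α) {s t} : (∀ i, CoprodRel (s i) (t i)) → CoprodRel (.op α s) (.op α t)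
  | eqn (e : V.Eqn) (x) :
      CoprodRel ((V.lhs e).eval AlgTerm.op x) ((V.rhs e).eval AlgTerm.op x)
  | mul (j) (α) (a : V.Ar α → (A j).carrier) :
      CoprodRel (.op α fun i => .var ⟨j, a i⟩) (.var ⟨j, (A j).op α a⟩)

/-- The congruence `CoprodRel`, as a setoid. -/
def coprodSetoid : Setoid (AlgTerm V.Ar (Σ j, (A j).carrier)) :=
  ⟨CoprodRel A, .refl, .symm, .trans⟩

/-- The operations of the coproduct. -/
noncomputable def coprodOp (α : V.Op) (x : V.Ar α → Quotient (coprodSetoid A)) :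
    Quotient (coprodSetoid A) :=
  Quotient.mk _ (.op α fun i => (x i).out)

theorem mk_op (α : V.Op) (t : V.Ar α → AlgTerm V.Ar (Σ j, (A j).carrier)) :
    (Quotient.mk (coprodSetoid A) (.op α t)) = coprodOp A α fun i => Quotient.mk _ (t i) :=
  Quotient.sound (CoprodRel.congr α fun i =>
    CoprodRel.symm (Quotient.mk_out (s := coprodSetoid A) (t i)))

/-- The coproduct of a family of algebras. -/
noncomputable def coprod : Alg V where
  carrier := Quotient (coprodSetoid A)
  op := coprodOp A
  sat e x := by
    have key : ∀ t : AlgTerm V.Ar (V.Vars e), t.eval (coprodOp A) x =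
        Quotient.mk (coprodSetoid A) (t.eval AlgTerm.op fun k => (x k).out) := by
      intro t
      rw [AlgTerm.map_eval (o' := coprodOp A) (Quotient.mk (coprodSetoid A)) (mk_op A)]
      simp only [Quotient.out_eq]
    rw [key, key]
    exact Quotient.sound (CoprodRel.eqn e _)

/-- The coprojections. -/
noncomputable def coprodι (j : J) : A j ⟶ coprod A where
  toFun a := Quotient.mk (coprodSetoid A) (.var ⟨j, a⟩)
  map_op α a := ((mk_op A α _).symm.trans (Quotient.sound (CoprodRel.mul j α a))).symm

variable {A} in
/-- The map out of the coproduct induced by a family of homomorphisms. -/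
noncomputable def coprodDesc {B : Alg V} (f : ∀ j, A j ⟶ B) : coprod A ⟶ B where
  toFun := Quotient.lift (fun t => t.eval B.op fun p => (f p.1).toFun p.2) (by
    intro s t h
    change CoprodRel A s t at h
    induction h with
    | refl => rfl
    | symm _ ih => exact ih.symm
    | trans _ _ ih₁ ih₂ => exact ih₁.trans ih₂
    | congr α _ ih =>
      simp only [AlgTerm.eval]
      congr 1
      funext i
      exact ih i
    | eqn e x =>
      have key := fun t => AlgTerm.map_eval (o := AlgTerm.op) (o' := B.op) (K := V.Vars e)
        (fun t : AlgTerm V.Ar (Σ j, (A j).carrier) =>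
          t.eval B.op fun p => (f p.1).toFun p.2) (fun _ _ => rfl) x t
      refine (key _).trans (Eq.trans ?_ (key _).symm)
      exact B.sat e _
    | mul j α a => exact ((f j).map_op α a).symm)
  map_op α x := by
    change B.op α _ = B.op α _
    congr 1
    funext i
    conv_rhs => rw [← Quotient.out_eq (x i)]
    rfl

theorem coprod_hom_ext {B : Alg V} {f g : coprod A ⟶ B}
    (h : ∀ j, coprodι A j ≫ f = coprodι A j ≫ g) : f = g := by
  ext q
  induction q using Quotient.ind with
  | _ t =>
    induction t with
    | var p => exact congrArg (fun k => Alg.Hom.toFun k p.2) (h p.1)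
    | op α t ih =>
      rw [mk_op]
      refine (f.map_op α _).trans (Eq.trans ?_ (g.map_op α _).symm)
      congr 1
      funext i
      exact ih i

instance : HasCoproducts.{u} (Alg V) :=
  hasCoproducts_of_colimit_cofans (fun A => Cofan.mk (coprod A) (coprodι A)) fun A =>
    Cofan.IsColimit.mk _ (fun s => coprodDesc s.inj) (fun _ _ => rfl) fun _ _ hm =>
      coprod_hom_ext A fun j => hm j

end Coproducts

/-! ### Coalgebras in a category with coproducts -/

variable (A : Type v) [Category.{u} A] [HasCoproducts.{u} A] (D : Variety.{u})

/-- Given co-operations on an object `R`, the induced operations on the set of morphisms from `R`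
to `B`. -/
noncomputable def homOp {A : Type v} [Category.{u} A] [HasCoproducts.{u} A] {D : Variety.{u}}
    {R : A} (co : (α : D.Op) → (R ⟶ ∐ fun _ : D.Ar α => R)) (B : A)
    (α : D.Op) (x : D.Ar α → (R ⟶ B)) : R ⟶ B :=
  co α ≫ Limits.Sigma.desc x

theorem homOp_comp {A : Type v} [Category.{u} A] [HasCoproducts.{u} A] {D : Variety.{u}}
    {R : A} (co : (α : D.Op) → (R ⟶ ∐ fun _ : D.Ar α => R)) {B B' : A} (g : B ⟶ B')
    (α : D.Op) (x : D.Ar α → (R ⟶ B)) :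
    homOp co B α x ≫ g = homOp co B' α fun i => x i ≫ g := by
  unfold homOp
  rw [Category.assoc]
  congr 1
  apply Limits.Sigma.hom_ext
  intro i
  simp

/-- The coalgebras of the variety `D` in the category `A`: objects with a co-operation for each
operation symbol of `D`, which cosatisfy the identities of `D`, i.e., such that the induced
operations on the morphisms to each object satisfy these identities. -/
structure Coalg : Type (max u v) where
  /-- the underlying object -/
  obj : A
  /-- the co-operations -/
  co : (α : D.Op) → (obj ⟶ ∐ fun _ : D.Ar α => obj)
  cosat : ∀ B : A, D.Satisfies (homOp co B)

namespace Coalg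

variable {A D}

/-- Morphisms of coalgebras: the morphisms of the underlying objects that make commuting squares
with the co-operations. -/
@[ext]
structure Hom (R S : Coalg A D) : Type u where
  /-- the underlying morphism -/
  hom : R.obj ⟶ S.obj
  comm : ∀ α : D.Op, R.co α ≫ Limits.Sigma.map (fun _ : D.Ar α => hom) = hom ≫ S.co α

instance : Category (Coalg A D) where
  Hom R S := Hom R S
  id R := ⟨𝟙 R.obj, fun α => by
    have : Limits.Sigma.map (fun _ : D.Ar α => 𝟙 R.obj) = 𝟙 _ := by
      apply Limits.Sigma.hom_ext; intro i; simp
    rw [this, Category.comp_id, Category.id_comp]⟩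
  comp {R S T} f g := ⟨f.hom ≫ g.hom, fun α => by
    have : Limits.Sigma.map (fun _ : D.Ar α => f.hom ≫ g.hom) =
        Limits.Sigma.map (fun _ => f.hom) ≫ Limits.Sigma.map (fun _ => g.hom) := by
      apply Limits.Sigma.hom_ext; intro i; simp
    rw [this, ← Category.assoc, f.comm, Category.assoc, g.comm, Category.assoc]⟩

@[ext]
theorem hom_ext {R S : Coalg A D} {f g : R ⟶ S} (h : f.hom = g.hom) : f = g := Hom.ext h

@[simp] theorem id_hom (R : Coalg A D) : (𝟙 R : R ⟶ R).hom = 𝟙 R.obj := rfl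

@[simp] theorem comp_hom {R S T : Coalg A D} (f : R ⟶ S) (g : S ⟶ T) :
    (f ≫ g).hom = f.hom ≫ g.hom := rfl

variable (A D) in
/-- The underlying object functor. -/
def forget : Coalg A D ⥤ A where
  obj R := R.obj
  map f := f.hom

/-- The algebra of morphisms from a coalgebra to an object. -/
noncomputable def homAlg (R : Coalg A D) (B : A) : Alg D where
  carrier := R.obj ⟶ B
  op := homOp R.co B
  sat := R.cosat B

/-- The functor to the variety `D` that a coalgebra represents. -/
noncomputable def homFunctor (R : Coalg A D) : A ⥤ Alg D where
  obj B := R.homAlg B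
  map {B B'} g :=
    { toFun := fun f => (f : R.obj ⟶ B) ≫ g
      map_op := fun α x => homOp_comp R.co g α x }
  map_id B := by ext f; exact Category.comp_id (X := R.obj) f
  map_comp g h := by ext f; exact (Category.assoc (W := R.obj) f g h).symm

theorem comp_homOp {R S : Coalg A D} (k : R ⟶ S) {B : A} (α : D.Op)
    (x : D.Ar α → (S.obj ⟶ B)) :
    k.hom ≫ homOp S.co B α x = homOp R.co B α fun i => k.hom ≫ x i := by
  unfold homOp
  rw [← Category.assoc, ← k.comm, Category.assoc]
  congr 1
  apply Limits.Sigma.hom_ext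
  intro i
  simp

variable (A D) in
/-- The contravariant functor taking a coalgebra to the functor that it represents. -/
noncomputable def corep : (Coalg A D)ᵒᵖ ⥤ (A ⥤ Alg D) where
  obj R := R.unop.homFunctor
  map {S R} k :=
    { app := fun B =>
        { toFun := fun f => k.unop.hom ≫ (f : S.unop.obj ⟶ B)
          map_op := fun α x => comp_homOp k.unop α x }
      naturality := fun B B' g => by
        ext f
        exact (Category.assoc k.unop.hom (f : S.unop.obj ⟶ B) g).symm }
  map_id R := by ext B f; exact Category.id_comp (X := R.unop.obj) f
  map_comp {R S T} k l := by
    ext B f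
    exact Category.assoc l.unop.hom k.unop.hom (f : R.unop.obj ⟶ B)

end Coalg

/-- A functor to a variety is representable if its composite with the underlying set functor is
representable in the classical sense, i.e., isomorphic to a covariant hom-functor. -/
def IsRep {A : Type v} [Category.{u} A] {D : Variety.{u}} : ObjectProperty (A ⥤ Alg D) :=
  fun F => (F ⋙ Alg.forget D).IsCorepresentable

/-- The category of representable functors from `A` to the variety `D`, as a full subcategory of
the category of all functors. -/
abbrev Rep (A : Type v) [Category.{u} A] (D : Variety.{u}) : Type (max u v (u + 1)) :=
  (IsRep (A := A) (D := D)).FullSubcategory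

/-- The least cardinal `ν ≥ κ` such that `ν ^ ι = ν` for all nonzero `ι < l`. -/
noncomputable def powMinus (κ l : Cardinal.{u}) : Cardinal.{u} :=
  sInf {ν | κ ≤ ν ∧ ∀ ι, 0 < ι → ι < l → ν ^ ι = ν}

end UnivAlg

/-! Co-operations are maps out of the underlying object, so colimits of coalgebras are formed on
underlying objects, and the category of coalgebras is cocomplete. A limit of `F` is a terminal cone.
Since the diagonal functor preserves colimits, the adjoint functor theorem reduces its existence to
that of a weakly terminal cone. The candidate is the colimit of all cones whose vertex is carried by
a subset of a fixed set `M` with `μ` elements, where `μ` is the exponent in the asserted bound;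
these cones form a small category.

This colimit is weakly terminal because every coalgebra `R` is the directed union of subcoalgebras
with at most `μ` elements (`exists_smallCoalg`, `exists_hom_colimitCone`). The obstacle is that the
inclusion of a subalgebra `Q` of `R` need not induce injections of copowers, and then the
co-operations need not restrict to `Q`, nor their identities descend. So `Q` is made pure, that is,
injective on all copowers. A relation in a copower of `R` has a derivation that involves fewer than
`λ_C` elements of `R` (`exists_support_rel`), and `Q` is closed off under adding these elements for
all related pairs of terms over `Q`. Copowers indexed by `λ_C` elements suffice
(`copMap_injective_of_large`), and by regularity the closing off stops after `λ_C` steps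
(`exists_closed`). Morphisms with image in a pure subcoalgebra factor through it, which makes the
union directed.

For the bound, each element of the limit is the image of an element of a small coalgebra `P`, and
the morphism from `P` to the limit is determined by the induced map from `P` to the limit of the
underlying sets. It remains to count the triples of a small coalgebra, an element of it and such a
map. The statements on representable functors follow from the Yoneda lemma, since a tuple of
morphisms out of `R` is a morphism out of a copower of `R`. -/

namespace UnivAlg

/-! ### Naturality of the induced operations on morphism sets -/

section HomOp

variable {A : Type v} [Category.{u} A] [HasCoproducts.{u} A] {D : Variety.{u}}

theorem eval_homOp_comp {R B B' : A} (co : (α : D.Op) → (R ⟶ ∐ fun _ : D.Ar α => R)) (g : B ⟶ B')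
    {K : Type u} (x : K → (R ⟶ B)) (t : AlgTerm D.Ar K) :
    t.eval (homOp co B) x ≫ g = t.eval (homOp co B') fun k => x k ≫ g :=
  AlgTerm.map_eval (fun f : R ⟶ B => f ≫ g) (fun α x => homOp_comp co g α x) x t

theorem comp_homOp_of_comm {R S : A} {co : (α : D.Op) → (R ⟶ ∐ fun _ : D.Ar α => R)}
    {co' : (α : D.Op) → (S ⟶ ∐ fun _ : D.Ar α => S)} {k : R ⟶ S}
    (hk : ∀ α, co α ≫ Limits.Sigma.map (fun _ : D.Ar α => k) = k ≫ co' α)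
    {B : A} (α : D.Op) (x : D.Ar α → (S ⟶ B)) :
    k ≫ homOp co' B α x = homOp co B α fun i => k ≫ x i := by
  unfold homOp
  rw [← Category.assoc, ← hk, Category.assoc]
  congr 1
  apply Limits.Sigma.hom_ext
  intro i
  simp

theorem comp_eval_homOp {R S : A} {co : (α : D.Op) → (R ⟶ ∐ fun _ : D.Ar α => R)}
    {co' : (α : D.Op) → (S ⟶ ∐ fun _ : D.Ar α => S)} {k : R ⟶ S}
    (hk : ∀ α, co α ≫ Limits.Sigma.map (fun _ : D.Ar α => k) = k ≫ co' α)
    {B : A} {K : Type u} (x : K → (S ⟶ B)) (t : AlgTerm D.Ar K) :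
    k ≫ t.eval (homOp co' B) x = t.eval (homOp co B) fun k' => k ≫ x k' :=
  AlgTerm.map_eval (fun f : S ⟶ B => k ≫ f) (fun α x => comp_homOp_of_comm hk α x) x t

theorem sigmaMap_comp {I : Type u} {X Y Z : A} (f : X ⟶ Y) (g : Y ⟶ Z) :
    Limits.Sigma.map (fun _ : I => f ≫ g) =
      Limits.Sigma.map (fun _ : I => f) ≫ Limits.Sigma.map (fun _ : I => g) := by
  apply Limits.Sigma.hom_ext
  intro i
  simp

/-- It suffices to check the identities at the universal elements, the coprojections to the
copowers. -/
theorem satisfies_homOp_of_coproj {R : A} {co : (α : D.Op) → (R ⟶ ∐ fun _ : D.Ar α => R)}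
    (h : ∀ e, (D.lhs e).eval (homOp co (∐ fun _ : D.Vars e => R))
        (Limits.Sigma.ι fun _ : D.Vars e => R) =
      (D.rhs e).eval (homOp co (∐ fun _ : D.Vars e => R))
        (Limits.Sigma.ι fun _ : D.Vars e => R)) (B : A) :
    D.Satisfies (homOp co B) := by
  intro e x
  have := congrArg (· ≫ Limits.Sigma.desc x) (h e)
  simpa only [eval_homOp_comp, Limits.Sigma.ι_desc] using this

end HomOp

/-! ### Colimits of coalgebras -/

namespace Coalg

section Colimits

variable {A : Type v} [Category.{u} A] [HasCoproducts.{u} A] {D : Variety.{u}}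
variable {J : Type u} [Category.{u} J] (F : J ⥤ Coalg A D) [HasColimit (F ⋙ forget A D)]

/-- The coprojections to the colimit of the underlying objects. -/
noncomputable def colimitι (j : J) : (F.obj j).obj ⟶ colimit (F ⋙ forget A D) :=
  colimit.ι (F ⋙ forget A D) j

theorem colimitι_w {i j : J} (f : i ⟶ j) : (F.map f).hom ≫ colimitι F j = colimitι F i :=
  colimit.w (F ⋙ forget A D) f

theorem colimitι_ext {X : A} {f g : colimit (F ⋙ forget A D) ⟶ X}
    (h : ∀ j, colimitι F j ≫ f = colimitι F j ≫ g) : f = g :=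
  colimit.hom_ext h

/-- The cocone that induces the co-operations on the colimit. -/
noncomputable def colimitCoCocone (α : D.Op) : Cocone (F ⋙ forget A D) where
  pt := ∐ fun _ : D.Ar α => colimit (F ⋙ forget A D)
  ι :=
    { app := fun j => (F.obj j).co α ≫ Limits.Sigma.map fun _ : D.Ar α => colimitι F j
      naturality := fun i j f => by
        refine Eq.trans ?_ (Category.comp_id _).symm
        change (F.map f).hom ≫ _ ≫ _ = _
        rw [← Category.assoc, ← (F.map f).comm α, Category.assoc, ← sigmaMap_comp,
          colimitι_w]
        rfl }

/-- The co-operations on the colimit of the underlying objects of a diagram of coalgebras. -/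
noncomputable def colimitCo (α : D.Op) :
    colimit (F ⋙ forget A D) ⟶ ∐ fun _ : D.Ar α => colimit (F ⋙ forget A D) :=
  colimit.desc (F ⋙ forget A D) (colimitCoCocone F α)

theorem ι_colimitCo (j : J) (α : D.Op) :
    (F.obj j).co α ≫ Limits.Sigma.map (fun _ : D.Ar α => colimitι F j) =
      colimitι F j ≫ colimitCo F α :=
  (colimit.ι_desc (colimitCoCocone F α) j).symm

/-- The colimit of a diagram of coalgebras. -/
noncomputable def colimitCoalg : Coalg A D where
  obj := colimit (F ⋙ forget A D)
  co := colimitCo F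
  cosat B e x := by
    -- The coprojections are jointly epic and respect the co-operations, so precomposing with them
    -- reduces the identity to one in the coalgebra `F.obj j`.
    apply colimitι_ext
    intro j
    rw [comp_eval_homOp (ι_colimitCo F j), comp_eval_homOp (ι_colimitCo F j)]
    exact (F.obj j).cosat B e _

/-- The colimit cocone of a diagram of coalgebras. -/
noncomputable def colimitCocone : Cocone F where
  pt := colimitCoalg F
  ι :=
    { app := fun j => ⟨colimitι F j, ι_colimitCo F j⟩
      naturality := fun i j f => by
        ext
        exact (colimit.cocone (F ⋙ forget A D)).ι.naturality f }

/-- The morphism of underlying objects induced by a cocone. -/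
noncomputable def colimitDesc (s : Cocone F) : colimit (F ⋙ forget A D) ⟶ s.pt.obj :=
  colimit.desc (F ⋙ forget A D) ((forget A D).mapCocone s)

theorem ι_colimitDesc (s : Cocone F) (j : J) :
    colimitι F j ≫ colimitDesc F s = (s.ι.app j).hom :=
  colimit.ι_desc ((forget A D).mapCocone s) j

theorem colimitDesc_comm (s : Cocone F) (α : D.Op) :
    colimitCo F α ≫ Limits.Sigma.map (fun _ : D.Ar α => colimitDesc F s) =
      colimitDesc F s ≫ s.pt.co α := by
  apply colimitι_ext
  intro j
  rw [← Category.assoc, ← ι_colimitCo, Category.assoc, ← sigmaMap_comp, ι_colimitDesc,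
    ← Category.assoc, ι_colimitDesc]
  exact (s.ι.app j).comm α

/-- `colimitCocone` is a colimit cocone. -/
noncomputable def isColimitColimitCocone : IsColimit (colimitCocone F) where
  desc s := ⟨colimitDesc F s, colimitDesc_comm F s⟩
  fac s j := hom_ext (ι_colimitDesc F s j)
  uniq s m hm := by
    ext
    apply colimitι_ext
    intro j
    exact (congrArg Hom.hom (hm j)).trans (ι_colimitDesc F s j).symm

end Colimits

instance (A : Type v) [Category.{u} A] [HasCoproducts.{u} A] [HasColimitsOfSize.{u, u} A]
    (D : Variety.{u}) : HasColimitsOfSize.{u, u} (Coalg A D) where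
  has_colimits_of_shape _ _ :=
    { has_colimit := fun F => ⟨⟨⟨colimitCocone F, isColimitColimitCocone F⟩⟩⟩ }

end Coalg

/-! ### Coequalizers of algebras -/

section Coequalizers

variable {V : Variety.{u}} {A B : Alg V} (f g : A ⟶ B)

/-- The congruence generated by the pairs `(f a, g a)`. -/
inductive CoeqRel : B.carrier → B.carrier → Prop
  | refl (s) : CoeqRel s s
  | symm {s t} : CoeqRel s t → CoeqRel t s
  | trans {s t r} : CoeqRel s t → CoeqRel t r → CoeqRel s r
  | congr (α) {s t : V.Ar α → B.carrier} :
      (∀ i, CoeqRel (s i) (t i)) → CoeqRel (B.op α s) (B.op α t)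
  | rel (a) : CoeqRel (f.toFun a) (g.toFun a)

/-- The congruence `CoeqRel`, as a setoid. -/
def coeqSetoid : Setoid B.carrier := ⟨CoeqRel f g, .refl, .symm, .trans⟩

/-- The operations on the quotient use chosen representatives, as arities may be infinite. The
congruence absorbs the choice, which makes the projection a homomorphism. -/
theorem mk_coeq_op (α : V.Op) (t : V.Ar α → B.carrier) :
    Quotient.mk (coeqSetoid f g) (B.op α t) =
      Quotient.mk _ (B.op α fun i => (Quotient.mk (coeqSetoid f g) (t i)).out) :=
  Quotient.sound (CoeqRel.congr α fun i =>
    CoeqRel.symm (Quotient.mk_out (s := coeqSetoid f g) (t i)))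

/-- The coequalizer of two homomorphisms. -/
noncomputable def coeqAlg : Alg V where
  carrier := Quotient (coeqSetoid f g)
  op α x := Quotient.mk _ (B.op α fun i => (x i).out)
  sat e x := by
    have key := fun t : AlgTerm V.Ar (V.Vars e) =>
      AlgTerm.map_eval (o := B.op)
        (o' := fun α x => Quotient.mk (coeqSetoid f g) (B.op α fun i => (x i).out))
        (Quotient.mk (coeqSetoid f g)) (mk_coeq_op f g) (fun k => (x k).out) t
    simp only [Quotient.out_eq] at key
    rw [← key, ← key, B.sat e]

/-- The projection to the coequalizer. -/
noncomputable def coeqπ : B ⟶ coeqAlg f g where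
  toFun := Quotient.mk _
  map_op α x := mk_coeq_op f g α x

variable {f g} in
/-- The map out of the coequalizer. -/
noncomputable def coeqDesc {X : Alg V} (k : B ⟶ X) (h : f ≫ k = g ≫ k) : coeqAlg f g ⟶ X where
  toFun := Quotient.lift k.toFun (by
    intro s t hst
    change CoeqRel f g s t at hst
    induction hst with
    | refl => rfl
    | symm _ ih => exact ih.symm
    | trans _ _ ih₁ ih₂ => exact ih₁.trans ih₂
    | congr α _ ih =>
      rw [k.map_op, k.map_op]
      congr 1
      funext i
      exact ih i
    | rel a => exact congrArg (fun m => Alg.Hom.toFun m a) h)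
  map_op α x := by
    refine (k.map_op α _).trans ?_
    congr 1
    funext i
    conv_rhs => rw [← Quotient.out_eq (x i)]
    rfl

instance : HasColimit (parallelPair f g) :=
  ⟨⟨⟨Cofork.ofπ (coeqπ f g) (by ext a; exact Quotient.sound (CoeqRel.rel a)),
    Cofork.IsColimit.mk _ (fun s => coeqDesc s.π s.condition) (fun _ => rfl) (by
      intro s m hm
      ext q
      induction q using Quotient.ind with
      | _ b => exact congrArg (fun k => Alg.Hom.toFun k b) hm)⟩⟩⟩

instance : HasCoequalizers (Alg V) := hasCoequalizers_of_hasColimit_parallelPair (Alg V)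

instance : HasColimitsOfSize.{u, u} (Alg V) := has_colimits_of_hasCoequalizers_and_coproducts

end Coequalizers

/-! ### Coalgebras and representable functors -/

section Corepresentable

variable {A : Type v} [Category.{u} A] {D : Variety.{u}} {G : A ⥤ Alg D} {R : A}
  (r : (G ⋙ Alg.forget D).CorepresentableBy R)

/-- The bijection of a representing object, in terms of underlying sets of algebras. -/
def repEquiv (B : A) : (R ⟶ B) ≃ (G.obj B).carrier := r.homEquiv

theorem repEquiv_comp {B B' : A} (g : B ⟶ B') (f : R ⟶ B) :
    repEquiv r B' (f ≫ g) = (G.map g).toFun (repEquiv r B f) := r.homEquiv_comp g f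

end Corepresentable

section Representable

variable {A : Type v} [Category.{u} A] [HasCoproducts.{u} A] {D : Variety.{u}}

namespace Coalg

theorem isRep_homFunctor (R : Coalg A D) : IsRep R.homFunctor :=
  Functor.CorepresentableBy.isCorepresentable (X := R.obj)
    { homEquiv := Equiv.refl _
      homEquiv_comp := fun _ _ => rfl }

/-- The morphism of underlying objects that induces a given natural transformation. -/
def natHom {R S : Coalg A D} (θ : S.homFunctor ⟶ R.homFunctor) : R.obj ⟶ S.obj :=
  (θ.app S.obj).toFun (𝟙 S.obj)

/-- The Yoneda lemma: naturality along `f`, evaluated at the identity of `S.obj`. -/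
theorem natTrans_app_apply {R S : Coalg A D} (θ : S.homFunctor ⟶ R.homFunctor) {B : A}
    (f : S.obj ⟶ B) : (θ.app B).toFun f = natHom θ ≫ f := by
  have h := congrArg (fun k => Alg.Hom.toFun k (𝟙 S.obj)) (θ.naturality f)
  change (θ.app B).toFun (𝟙 S.obj ≫ f) = _ at h
  rw [Category.id_comp] at h
  exact h

/-- The coprojections form the universal tuple, so the induced operations determine the
co-operations. -/
theorem homOp_coproj (R : Coalg A D) (α : D.Op) :
    homOp R.co (∐ fun _ : D.Ar α => R.obj) α (Limits.Sigma.ι fun _ : D.Ar α => R.obj) = R.co α := by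
  have h : Limits.Sigma.desc (Limits.Sigma.ι fun _ : D.Ar α => R.obj) = 𝟙 _ := by
    apply Limits.Sigma.hom_ext
    intro i
    simp
  rw [homOp, h, Category.comp_id]

theorem natHom_homOp {R S : Coalg A D} (θ : S.homFunctor ⟶ R.homFunctor) {B : A} (α : D.Op)
    (x : D.Ar α → (S.obj ⟶ B)) :
    natHom θ ≫ homOp S.co B α x = homOp R.co B α fun i => natHom θ ≫ x i :=
  (natTrans_app_apply θ _).symm.trans (((θ.app B).map_op α x).trans
    (congrArg (homOp R.co B α) (funext fun i => natTrans_app_apply θ (x i))))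

theorem natHom_comm {R S : Coalg A D} (θ : S.homFunctor ⟶ R.homFunctor) (α : D.Op) :
    R.co α ≫ Limits.Sigma.map (fun _ : D.Ar α => natHom θ) = natHom θ ≫ S.co α := by
  rw [← S.homOp_coproj α, natHom_homOp, homOp]
  congr 1

/-- The morphism of coalgebras that induces a given natural transformation. -/
def ofNatTrans {R S : Coalg A D} (θ : S.homFunctor ⟶ R.homFunctor) : R ⟶ S where
  hom := natHom θ
  comm := natHom_comm θ

instance : (corep A D).Full where
  map_surjective {S R} θ := ⟨(ofNatTrans (R := R.unop) (S := S.unop) θ).op, by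
    ext B f
    exact (natTrans_app_apply (R := R.unop) (S := S.unop) θ f).symm⟩

instance : (corep A D).Faithful where
  map_injective {S R} k l h := by
    have h' : k.unop = l.unop := by
      ext
      have := congrArg (fun θ => Alg.Hom.toFun (NatTrans.app θ S.unop.obj) (𝟙 S.unop.obj)) h
      change k.unop.hom ≫ 𝟙 _ = l.unop.hom ≫ 𝟙 _ at this
      simpa using this
    exact Quiver.Hom.unop_inj h'

end Coalg

section OfCorepresentable

variable {G : A ⥤ Alg D} {R : A} (r : (G ⋙ Alg.forget D).CorepresentableBy R)

/-- The co-operations on a representing object. -/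
noncomputable def repCo (α : D.Op) : R ⟶ ∐ fun _ : D.Ar α => R :=
  (repEquiv r _).symm ((G.obj _).op α fun i => repEquiv r _ (Limits.Sigma.ι (fun _ => R) i))

/-- By definition of `repCo` this holds at the universal tuple of coprojections; naturality along
`Limits.Sigma.desc x` carries it to every tuple. -/
theorem repEquiv_homOp {B : A} (α : D.Op) (x : D.Ar α → (R ⟶ B)) :
    repEquiv r B (homOp (repCo r) B α x) = (G.obj B).op α fun i => repEquiv r B (x i) := by
  unfold homOp repCo
  rw [repEquiv_comp, Equiv.apply_symm_apply, (G.map _).map_op]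
  congr 1
  funext i
  rw [← repEquiv_comp]
  simp

/-- The coalgebra structure on an object that represents an algebra-valued functor. -/
noncomputable def repCoalg : Coalg A D where
  obj := R
  co := repCo r
  cosat B e x := by
    apply (repEquiv r B).injective
    rw [AlgTerm.map_eval (repEquiv r B) (repEquiv_homOp r),
      AlgTerm.map_eval (repEquiv r B) (repEquiv_homOp r)]
    exact (G.obj B).sat e _

/-- A bijective homomorphism of algebras is an isomorphism. -/
def algIsoOfEquiv {V : Variety.{u}} {X Y : Alg V} (e : X.carrier ≃ Y.carrier)
    (he : ∀ α x, e (X.op α x) = Y.op α fun i => e (x i)) : X ≅ Y where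
  hom := ⟨e, he⟩
  inv := ⟨e.symm, fun α x => by
    rw [Equiv.symm_apply_eq, he]
    simp⟩
  hom_inv_id := by ext a; exact e.symm_apply_apply a
  inv_hom_id := by ext a; exact e.apply_symm_apply a

/-- The functor represented by the coalgebra `repCoalg`. -/
noncomputable def repCoalgIso : (repCoalg r).homFunctor ≅ G :=
  NatIso.ofComponents (fun B => algIsoOfEquiv (repEquiv r B) (repEquiv_homOp r)) (by
    intro B B' g
    ext f
    exact repEquiv_comp r g f)

end OfCorepresentable

variable (A D) in
/-- The functor from coalgebras to representable functors. -/
noncomputable def toRep : (Coalg A D)ᵒᵖ ⥤ Rep A D :=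
  (IsRep (A := A) (D := D)).lift (Coalg.corep A D) fun R => R.unop.isRep_homFunctor

instance : (toRep A D).Full :=
  inferInstanceAs ((IsRep (A := A) (D := D)).lift (Coalg.corep A D) fun R : (Coalg A D)ᵒᵖ =>
    show IsRep ((Coalg.corep A D).obj R) from R.unop.isRep_homFunctor).Full

instance : (toRep A D).Faithful :=
  inferInstanceAs ((IsRep (A := A) (D := D)).lift (Coalg.corep A D) fun R : (Coalg A D)ᵒᵖ =>
    show IsRep ((Coalg.corep A D).obj R) from R.unop.isRep_homFunctor).Faithful

instance : (toRep A D).EssSurj where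
  mem_essImage G := by
    obtain ⟨R, ⟨r⟩⟩ := G.property.has_corepresentation
    exact ⟨Opposite.op (repCoalg r),
      ⟨(IsRep (A := A) (D := D)).isoMk (repCoalgIso r)⟩⟩

instance : (toRep A D).IsEquivalence where

end Representable

/-! ### Terms -/

namespace AlgTerm

variable {Op : Type u} {Ar : Op → Type u} {X Y : Type u}

/-- Renaming of the indeterminates of a term. -/
def map (f : X → Y) (t : AlgTerm Ar X) : AlgTerm Ar Y := t.eval op fun k => var (f k)

/-- Terms are free, so this holds before any identities are imposed. It can fail for the induced map
of copowers, which are quotients of terms; this failure is what purity has to exclude. -/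
theorem map_injective {f : X → Y} (hf : Function.Injective f) :
    Function.Injective (map (Ar := Ar) f) := by
  intro s
  induction s with
  | var x =>
    intro t h
    cases t with
    | var y => exact congrArg var (hf (AlgTerm.var.inj h))
    | op β t => cases h
  | op α s ih =>
    intro t h
    cases t with
    | var y => cases h
    | op β t =>
      obtain ⟨rfl, h⟩ := AlgTerm.op.inj h
      congr 1
      funext i
      exact ih i (congrFun (eq_of_heq h) i)

theorem map_eval_op (f : X → Y) {K : Type u} (x : K → AlgTerm Ar X) (t : AlgTerm Ar K) :
    (t.eval op x).map f = t.eval op fun k => (x k).map f :=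
  map_eval (map f) (fun _ _ => rfl) x t

end AlgTerm

/-! ### Small sets of elements -/

/-- Here regularity enters: supports stay smaller than `V.lam` through inductions on terms and on
derivations, which branch over arities or sets of indeterminates. -/
theorem Variety.mk_iUnion_lt (V : Variety.{u}) {ι X : Type u} {S : ι → Set X}
    (hι : Cardinal.mk ι < V.lam) (hS : ∀ i, Cardinal.mk (S i) < V.lam) :
    Cardinal.mk (⋃ i, S i) < V.lam :=
  (Cardinal.card_iUnion_lt_iff_forall_of_isRegular V.lam_regular hι).2 hS

theorem Variety.mk_singleton_lt (V : Variety.{u}) {X : Type u} (x : X) :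
    Cardinal.mk ({x} : Set X) < V.lam := by
  rw [Cardinal.mk_singleton]
  exact Cardinal.one_lt_aleph0.trans_le V.lam_regular.aleph0_le

theorem Variety.mk_union_lt (V : Variety.{u}) {X : Type u} {S T : Set X}
    (hS : Cardinal.mk S < V.lam) (hT : Cardinal.mk T < V.lam) :
    Cardinal.mk (S ∪ T : Set X) < V.lam :=
  (Cardinal.mk_union_le S T).trans_lt
    (Cardinal.add_lt_of_lt V.lam_regular.aleph0_le hS hT)

theorem Variety.mk_range_lt (V : Variety.{u}) {ι X : Type u} (f : ι → X)
    (hι : Cardinal.mk ι < V.lam) : Cardinal.mk (Set.range f) < V.lam :=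
  Cardinal.mk_range_le.trans_lt hι

/-! ### Invertible homomorphisms -/

theorem Alg.leftInverse_of_comp_eq_id {V : Variety.{u}} {A B : Alg V} {f : A ⟶ B} {g : B ⟶ A}
    (h : f ≫ g = 𝟙 A) : Function.LeftInverse g.toFun f.toFun :=
  fun a => congrArg (fun k => Alg.Hom.toFun k a) h

theorem Alg.iso_injective {V : Variety.{u}} {A B : Alg V} (e : A ≅ B) :
    Function.Injective e.hom.toFun :=
  (Alg.leftInverse_of_comp_eq_id e.hom_inv_id).injective

theorem Alg.iso_surjective {V : Variety.{u}} {A B : Alg V} (e : A ≅ B) :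
    Function.Surjective e.hom.toFun :=
  (Alg.leftInverse_of_comp_eq_id e.inv_hom_id).surjective

/-! ### Copowers of algebras -/

section Copowers

variable {V : Variety.{u}} (I : Type u) {J : Type u} {Q R : Alg V}

/-- The homomorphism of copowers induced by a homomorphism. -/
noncomputable def copMap (m : Q ⟶ R) : coprod (fun _ : I => Q) ⟶ coprod fun _ : I => R :=
  coprodDesc fun i => m ≫ coprodι (fun _ : I => R) i

/-- The effect of a homomorphism on the generators of a copower. -/
def genMap (m : Q ⟶ R) (p : Σ _ : I, Q.carrier) : Σ _ : I, R.carrier := ⟨p.1, m.toFun p.2⟩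

variable {I}

theorem genMap_injective {m : Q ⟶ R} (hm : Function.Injective m.toFun) :
    Function.Injective (genMap I m) := by
  rintro ⟨i, q⟩ ⟨j, r⟩ h
  obtain ⟨rfl, h⟩ := Sigma.mk.inj h
  obtain rfl : q = r := hm (eq_of_heq h)
  rfl

theorem mk_map (f : (Σ _ : I, Q.carrier) → Σ _ : J, R.carrier)
    (t : AlgTerm V.Ar (Σ _ : I, Q.carrier)) :
    (Quotient.mk (coprodSetoid fun _ : J => R) (t.map f)) =
      t.eval (coprod fun _ : J => R).op fun p => Quotient.mk _ (.var (f p)) :=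
  AlgTerm.map_eval (o := AlgTerm.op) _ (mk_op fun _ : J => R) _ t

theorem copMap_mk (m : Q ⟶ R) (t : AlgTerm V.Ar (Σ _ : I, Q.carrier)) :
    (copMap I m).toFun (Quotient.mk _ t) = Quotient.mk _ (t.map (genMap I m)) :=
  (mk_map _ t).symm

/-- The homomorphism of copowers induced by a map of index sets. -/
noncomputable def copRename (f : I → J) (Q : Alg V) :
    coprod (fun _ : I => Q) ⟶ coprod fun _ : J => Q :=
  coprodDesc fun i => coprodι (fun _ : J => Q) (f i)

theorem copRename_copMap (f : I → J) (m : Q ⟶ R) :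
    copRename f Q ≫ copMap J m = copMap I m ≫ copRename f R := by
  apply coprod_hom_ext
  intro i
  rfl

theorem copRename_comp {K : Type u} (f : I → J) (g : J → K) :
    copRename f Q ≫ copRename g Q = copRename (g ∘ f) Q := by
  apply coprod_hom_ext
  intro i
  rfl

/-- An element of a copower of `R` involves few elements of `R`. -/
theorem exists_support_term (t : AlgTerm V.Ar (Σ _ : I, R.carrier)) :
    ∃ S : Set R.carrier, Cardinal.mk S < V.lam ∧ ∀ (Q : Alg V) (m : Q ⟶ R),
      S ⊆ Set.range m.toFun → ∃ t' : AlgTerm V.Ar (Σ _ : I, Q.carrier),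
        t'.map (genMap I m) = t := by
  induction t with
  | var p =>
    refine ⟨{p.2}, V.mk_singleton_lt _, fun Q m h => ?_⟩
    obtain ⟨q, hq⟩ := h rfl
    refine ⟨.var ⟨p.1, q⟩, ?_⟩
    exact congrArg (fun r => AlgTerm.var (Sigma.mk p.1 r)) hq
  | op α t ih =>
    choose S hS h using ih
    refine ⟨⋃ i, S i, V.mk_iUnion_lt (V.ar_lt α) hS, fun Q m hm => ?_⟩
    choose t' ht' using fun i => h i Q m ((Set.subset_iUnion S i).trans hm)
    exact ⟨.op α t', congrArg (AlgTerm.op α) (funext ht')⟩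

/-- A relation that holds in a copower of `R` is witnessed by few elements of `R`. -/
theorem exists_support_rel {s t : AlgTerm V.Ar (Σ _ : I, R.carrier)}
    (h : CoprodRel (fun _ : I => R) s t) :
    ∃ S : Set R.carrier, Cardinal.mk S < V.lam ∧ ∀ (Q : Alg V) (m : Q ⟶ R),
      Function.Injective m.toFun → S ⊆ Set.range m.toFun →
        ∃ s' t' : AlgTerm V.Ar (Σ _ : I, Q.carrier), s'.map (genMap I m) = s ∧
          t'.map (genMap I m) = t ∧ CoprodRel (fun _ : I => Q) s' t' := by
  induction h with
  | refl s =>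
    obtain ⟨S, hS, h⟩ := exists_support_term s
    refine ⟨S, hS, fun Q m _ hm => ?_⟩
    obtain ⟨s', hs'⟩ := h Q m hm
    exact ⟨s', s', hs', hs', .refl _⟩
  | symm _ ih =>
    obtain ⟨S, hS, h⟩ := ih
    refine ⟨S, hS, fun Q m hi hm => ?_⟩
    obtain ⟨s', t', hs, ht, hr⟩ := h Q m hi hm
    exact ⟨t', s', ht, hs, hr.symm⟩
  | trans _ _ ih₁ ih₂ =>
    obtain ⟨S, hS, h⟩ := ih₁
    obtain ⟨T, hT, k⟩ := ih₂
    refine ⟨S ∪ T, V.mk_union_lt hS hT, fun Q m hi hm => ?_⟩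
    obtain ⟨s', t', hs, ht, hr⟩ := h Q m hi (Set.subset_union_left.trans hm)
    obtain ⟨t'', r', ht', hr', hr''⟩ := k Q m hi (Set.subset_union_right.trans hm)
    -- The two derivations lift to `Q` separately; injectivity identifies the two lifts of the
    -- middle term, so that they can be composed.
    obtain rfl := AlgTerm.map_injective (genMap_injective hi) (ht.trans ht'.symm)
    exact ⟨s', r', hs, hr', hr.trans hr''⟩
  | congr α _ ih =>
    choose S hS h using ih
    refine ⟨⋃ i, S i, V.mk_iUnion_lt (V.ar_lt α) hS, fun Q m hi hm => ?_⟩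
    choose s' t' hs ht hr using fun i => h i Q m hi ((Set.subset_iUnion S i).trans hm)
    exact ⟨.op α s', .op α t', congrArg (AlgTerm.op α) (funext hs),
      congrArg (AlgTerm.op α) (funext ht), .congr α hr⟩
  | eqn e x =>
    choose S hS h using fun k => exists_support_term (x k)
    refine ⟨⋃ i, S i, V.mk_iUnion_lt (V.vars_lt e) hS, fun Q m hi hm => ?_⟩
    choose x' hx' using fun k => h k Q m ((Set.subset_iUnion S k).trans hm)
    refine ⟨_, _, ?_, ?_, .eqn e x'⟩ <;> rw [AlgTerm.map_eval_op] <;> simp only [hx']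
  | mul j α a =>
    refine ⟨Set.range a, V.mk_range_lt a (V.ar_lt α), fun Q m hi hm => ?_⟩
    choose b hb using fun i => hm ⟨i, rfl⟩
    obtain rfl : (fun i => m.toFun (b i)) = a := funext hb
    refine ⟨_, _, ?_, ?_, .mul j α b⟩
    · rfl
    · exact congrArg (fun r => AlgTerm.var (Sigma.mk j r)) (m.map_op α b)

/-- An element of a copower involves few indices. -/
theorem exists_index_support (z : (coprod fun _ : I => Q).carrier) :
    ∃ I₀ : Set I, Cardinal.mk I₀ < V.lam ∧
      ∀ h : I → I, (∀ i ∈ I₀, h i = i) → (copRename h Q).toFun z = z := by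
  induction z using Quotient.ind with
  | _ t =>
    induction t with
    | var p =>
      refine ⟨{p.1}, V.mk_singleton_lt _, fun h hh => ?_⟩
      exact congrArg (fun i => (coprodι (fun _ : I => Q) i).toFun p.2) (hh p.1 rfl)
    | op α t ih =>
      choose S hS h using ih
      refine ⟨⋃ i, S i, V.mk_iUnion_lt (V.ar_lt α) hS, fun k hk => ?_⟩
      rw [mk_op]
      refine ((copRename k Q).map_op α _).trans ?_
      exact congrArg ((coprod fun _ : I => Q).op α)
        (funext fun i => h i k fun j hj => hk j (Set.mem_iUnion_of_mem i hj))

/-- If a homomorphism induces an injective homomorphism of sufficiently large copowers, then it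
induces injective homomorphisms of all copowers. -/
theorem copMap_injective_of_large {K : Type u} (hK : V.lam ≤ Cardinal.mk K) {m : Q ⟶ R}
    (hm : Function.Injective (copMap K m).toFun) (I : Type u) :
    Function.Injective (copMap I m).toFun := by
  classical
  intro s t hst
  rcases isEmpty_or_nonempty I with hI | hI
  · have h : copMap I m ≫ coprodDesc (fun i => isEmptyElim i) = 𝟙 (coprod fun _ : I => Q) :=
      coprod_hom_ext _ fun i => isEmptyElim i
    exact (Alg.leftInverse_of_comp_eq_id h).injective hst
  · obtain ⟨S, hS, hs⟩ := exists_index_support s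
    obtain ⟨T, hT, ht⟩ := exists_index_support t
    have hlt : Cardinal.mk (S ∪ T : Set I) < Cardinal.mk K := (V.mk_union_lt hS hT).trans_le hK
    obtain ⟨⟨f, hf⟩⟩ := Cardinal.le_def _ _ |>.1 hlt.le
    have hKne : Nonempty K := Cardinal.mk_ne_zero_iff.1 (ne_bot_of_gt hlt)
    -- The two elements involve fewer than `V.lam` indices, which embed in `K`. Reindexing along
    -- `f'` moves the equation to the `K`-copower, and reindexing along `g` brings it back; the
    -- value of `f'` off `S ∪ T` is irrelevant.
    let f' : I → K := fun i => if h : i ∈ S ∪ T then f ⟨i, h⟩ else Classical.arbitrary K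
    have hinj : Set.InjOn f' (S ∪ T) := by
      intro i hi j hj hij
      simp only [f', dif_pos hi, dif_pos hj] at hij
      exact congrArg Subtype.val (hf hij)
    let g := Function.invFunOn f' (S ∪ T)
    have hgf : ∀ i ∈ S ∪ T, (g ∘ f') i = i := fun i hi => hinj.leftInvOn_invFunOn hi
    have key : (copRename f' Q).toFun s = (copRename f' Q).toFun t := by
      apply hm
      have h := fun z => congrArg (fun k => Alg.Hom.toFun k z) (copRename_copMap f' m)
      exact (h s).trans ((congrArg (copRename f' R).toFun hst).trans (h t).symm)
    rw [← hs (g ∘ f') fun i hi => hgf i (Or.inl hi), ← ht (g ∘ f') fun i hi => hgf i (Or.inr hi),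
      ← copRename_comp]
    exact congrArg (copRename g Q).toFun key

/-- A homomorphism is injective if it is injective on a nonempty copower. -/
theorem injective_of_copMap {m : Q ⟶ R} (j : I)
    (hm : Function.Injective (copMap I m).toFun) : Function.Injective m.toFun := by
  intro a b h
  have h' : (coprodι (fun _ : I => Q) j).toFun a = (coprodι (fun _ : I => Q) j).toFun b :=
    hm (congrArg (coprodι (fun _ : I => R) j).toFun h)
  -- The codiagonal splits the coprojection.
  have hc : coprodι (fun _ : I => Q) j ≫ coprodDesc (fun _ => 𝟙 Q) = 𝟙 Q := rfl
  exact (Alg.leftInverse_of_comp_eq_id hc).injective h'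

variable (I) in
/-- The comparison of the two copowers. -/
noncomputable def copIso (Q : Alg V) : coprod (fun _ : I => Q) ≅ ∐ fun _ : I => Q where
  hom := coprodDesc fun i => Limits.Sigma.ι (fun _ : I => Q) i
  inv := Limits.Sigma.desc fun i => coprodι (fun _ : I => Q) i
  hom_inv_id := by
    apply coprod_hom_ext
    intro i
    rw [← Category.assoc]
    change Limits.Sigma.ι (fun _ : I => Q) i ≫ _ = _
    rw [Limits.Sigma.ι_desc, Category.comp_id]
  inv_hom_id := by
    apply Limits.Sigma.hom_ext
    intro i
    rw [← Category.assoc, Limits.Sigma.ι_desc, Category.comp_id]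
    rfl

/-- Arguments about elements take place in the explicit quotient of terms; this naturality moves
them to `∐`, where the co-operations take their values. -/
theorem copMap_copIso (m : Q ⟶ R) :
    copMap I m ≫ (copIso I R).hom = (copIso I Q).hom ≫ Limits.Sigma.map fun _ => m := by
  apply coprod_hom_ext
  intro i
  change m ≫ Limits.Sigma.ι (fun _ : I => R) i = Limits.Sigma.ι (fun _ : I => Q) i ≫ _
  simp

theorem copMap_copIso_apply (m : Q ⟶ R) (z : (coprod fun _ : I => Q).carrier) :
    (copIso I R).hom.toFun ((copMap I m).toFun z) =
      (Limits.Sigma.map fun _ : I => m).toFun ((copIso I Q).hom.toFun z) :=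
  congrArg (fun k => Alg.Hom.toFun k z) (copMap_copIso m)

theorem sigmaMap_injective {m : Q ⟶ R} (hm : Function.Injective (copMap I m).toFun) :
    Function.Injective (Limits.Sigma.map fun _ : I => m).toFun := by
  intro a b h
  obtain ⟨a, rfl⟩ := Alg.iso_surjective (copIso I Q) a
  obtain ⟨b, rfl⟩ := Alg.iso_surjective (copIso I Q) b
  rw [← copMap_copIso_apply, ← copMap_copIso_apply] at h
  rw [hm (Alg.iso_injective _ h)]

/-- An element of a copower of `R` comes from a copower of `Q`, as soon as `Q` contains certain
few elements of `R`. -/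
theorem exists_support (z : (∐ fun _ : I => R).carrier) :
    ∃ S : Set R.carrier, Cardinal.mk S < V.lam ∧ ∀ (Q : Alg V) (m : Q ⟶ R),
      S ⊆ Set.range m.toFun → z ∈ Set.range (Limits.Sigma.map fun _ : I => m).toFun := by
  obtain ⟨z, rfl⟩ := Alg.iso_surjective (copIso I R) z
  induction z using Quotient.ind with
  | _ t =>
    obtain ⟨S, hS, h⟩ := exists_support_term t
    refine ⟨S, hS, fun Q m hm => ?_⟩
    obtain ⟨t', rfl⟩ := h Q m hm
    exact ⟨_, (copMap_copIso_apply m (Quotient.mk _ t')).symm.trans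
      (congrArg (copIso I R).hom.toFun (copMap_mk m t'))⟩

end Copowers

/-! ### Cardinalities -/

section Cardinals

theorem mk_iUnion_le_of_le {ι X : Type u} {μ : Cardinal.{u}} (hμ : Cardinal.aleph0 ≤ μ)
    {S : ι → Set X} (hι : Cardinal.mk ι ≤ μ) (hS : ∀ i, Cardinal.mk (S i) ≤ μ) :
    Cardinal.mk (⋃ i, S i) ≤ μ := by
  refine (Cardinal.mk_iUnion_le S).trans ?_
  refine (mul_le_mul' hι (ciSup_le' hS)).trans ?_
  rw [Cardinal.mul_eq_self hμ]

/-- Closing off a set under an operation on small subsets, in `lam` steps. -/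
theorem exists_closed {X : Type u} {lam μ : Cardinal.{u}} (hlam : lam.IsRegular) (hle : lam ≤ μ)
    (Φ : Set X → Set X) (hsub : ∀ Y, Y ⊆ Φ Y)
    (hΦ : ∀ Y : Set X, Cardinal.mk Y ≤ μ → Cardinal.mk (Φ Y) ≤ μ) (X₀ : Set X)
    (hX₀ : Cardinal.mk X₀ ≤ μ) :
    ∃ Q : Set X, X₀ ⊆ Q ∧ Cardinal.mk Q ≤ μ ∧
      ∀ S ⊆ Q, Cardinal.mk S < lam → ∃ Y, S ⊆ Y ∧ Φ Y ⊆ Q := by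
  have hμ := hlam.aleph0_le.trans hle
  -- Stage `o` contains `Φ` of every earlier stage. As whole stages are used, `Φ` need not be
  -- monotone.
  let G : lam.ord.ToType → Set X := WellFoundedLT.fix
    fun o ih => X₀ ∪ ⋃ p : Set.Iio o, Φ (ih p.1 p.2)
  have hG : ∀ o, G o = X₀ ∪ ⋃ p : Set.Iio o, Φ (G p.1) := fun o => WellFoundedLT.fix_eq _ o
  have hcof : Order.cof lam.ord.ToType = lam := by
    rw [Ordinal.cof_toType, hlam.cof_ord]
  -- By regularity, fewer than `lam` stages have a common strict upper bound; hence a small subset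
  -- of the union already lies in a single stage.
  have hbound : ∀ T : Set lam.ord.ToType, Cardinal.mk T < lam → ∃ b, ∀ o ∈ T, o < b := by
    intro T hT
    by_contra! h
    exact (Order.cof_le (s := T) h).not_gt (hT.trans_eq hcof.symm)
  have hlt : ∀ p o, p < o → Φ (G p) ⊆ G o := fun p o hpo => by
    rw [hG o]
    exact (Set.subset_iUnion (fun p : Set.Iio o => Φ (G p.1)) ⟨p, hpo⟩).trans
      Set.subset_union_right
  have hcard : ∀ o, Cardinal.mk (G o) ≤ μ := by
    intro o
    induction o using WellFoundedLT.induction with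
    | _ o ih =>
      rw [hG o]
      refine (Cardinal.mk_union_le _ _).trans ((add_le_add hX₀ ?_).trans
        (Cardinal.add_eq_self hμ).le)
      refine mk_iUnion_le_of_le hμ ?_ fun p => hΦ _ (ih p.1 p.2)
      refine (Cardinal.mk_set_le _).trans ?_
      rw [Cardinal.mk_toType, Cardinal.card_ord]
      exact hle
  refine ⟨⋃ o, G o, ?_, ?_, ?_⟩
  · obtain ⟨b, -⟩ := hbound ∅ (by simpa using hlam.pos)
    refine Set.Subset.trans ?_ (Set.subset_iUnion G b)
    rw [hG b]
    exact Set.subset_union_left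
  · refine mk_iUnion_le_of_le hμ ?_ hcard
    rw [Cardinal.mk_toType, Cardinal.card_ord]
    exact hle
  · intro S hS hSlt
    choose o ho using fun x : S => Set.mem_iUnion.1 (hS x.2)
    obtain ⟨b, hb⟩ := hbound (Set.range o) (Cardinal.mk_range_le.trans_lt hSlt)
    obtain ⟨c, hc⟩ := hbound {b} (by
      rw [Cardinal.mk_singleton]
      exact Cardinal.one_lt_aleph0.trans_le hlam.aleph0_le)
    refine ⟨G b, fun x hx => ?_, (hlt b c (hc b rfl)).trans (Set.subset_iUnion G c)⟩
    exact hlt _ _ (hb _ ⟨⟨x, hx⟩, rfl⟩) (hsub _ (ho ⟨x, hx⟩))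

/-- The terms as a type of well-founded trees. -/
def AlgTerm.toW {Op : Type u} {Ar : Op → Type u} {X : Type u} :
    AlgTerm Ar X → WType (Sum.elim (fun _ : X => PEmpty.{u + 1}) Ar)
  | .var x => ⟨.inl x, PEmpty.elim⟩
  | .op α t => ⟨.inr α, fun i => (t i).toW⟩

theorem AlgTerm.toW_injective {Op : Type u} {Ar : Op → Type u} {X : Type u} :
    Function.Injective (AlgTerm.toW (Ar := Ar) (X := X)) := by
  intro s
  induction s with
  | var x =>
    intro t h
    cases t with
    | var y =>
      rw [toW, toW] at h
      injection h with h
      rw [Sum.inl.inj h]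
    | op β t =>
      rw [toW, toW] at h
      injection h with h
      cases h
  | op α s ih =>
    intro t h
    cases t with
    | var y =>
      rw [toW, toW] at h
      injection h with h
      cases h
    | op β t =>
      rw [toW, toW] at h
      injection h with h h'
      obtain rfl := Sum.inr.inj h
      congr 1
      funext i
      exact ih i (congrFun (eq_of_heq h') i)

/-- A set of `κ` elements is large enough to be closed under forming nodes: indeterminates are nodes
without children, and each operation symbol contributes at most `κ` nodes. -/
theorem AlgTerm.mk_le {Op : Type u} {Ar : Op → Type u} {X : Type u} {κ : Cardinal.{u}}
    (hκ : Cardinal.aleph0 ≤ κ) (hOp : Cardinal.mk Op ≤ κ) (hX : Cardinal.mk X ≤ κ)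
    (hAr : ∀ α, κ ^ Cardinal.mk (Ar α) ≤ κ) : Cardinal.mk (AlgTerm Ar X) ≤ κ := by
  refine (Cardinal.mk_le_of_injective AlgTerm.toW_injective).trans
    (WType.cardinalMk_le_of_le ?_)
  have h : ∀ a : X ⊕ Op, κ ^ Cardinal.mk (Sum.elim (fun _ : X => PEmpty.{u + 1}) Ar a) ≤ κ := by
    rintro (x | α)
    · simpa using Cardinal.one_le_aleph0.trans hκ
    · exact hAr α
  refine (Cardinal.sum_le_sum _ _ h).trans ?_
  rw [Cardinal.sum_const', Cardinal.mk_sum, Cardinal.lift_id, Cardinal.lift_id]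
  exact (mul_le_mul' (Cardinal.add_le_of_le hκ hX hOp) le_rfl).trans (Cardinal.mul_eq_self hκ).le

theorem AlgTerm.map_map {Op : Type u} {Ar : Op → Type u} {X Y Z : Type u} (f : X → Y) (g : Y → Z)
    (t : AlgTerm Ar X) : (t.map f).map g = t.map (g ∘ f) :=
  AlgTerm.map_eval_op g (fun k => var (f k)) t

/-- A term involves few indeterminates. -/
theorem Variety.exists_leaves (V : Variety.{u}) {X : Type u} (t : AlgTerm V.Ar X) :
    ∃ S : Set X, Cardinal.mk S < V.lam ∧ ∃ t' : AlgTerm V.Ar S, t'.map Subtype.val = t := by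
  induction t with
  | var x => exact ⟨{x}, V.mk_singleton_lt x, .var ⟨x, rfl⟩, rfl⟩
  | op α t ih =>
    choose S hS t' ht' using ih
    refine ⟨⋃ i, S i, V.mk_iUnion_lt (V.ar_lt α) hS,
      .op α fun i => (t' i).map fun x => ⟨x.1, Set.mem_iUnion_of_mem i x.2⟩, ?_⟩
    refine congrArg (AlgTerm.op α) (funext fun i => ?_)
    exact (AlgTerm.map_map _ _ _).trans (ht' i)

/-- The cardinals that are large enough for closing off in algebras of a variety. -/
structure IsLarge (V : Variety.{u}) (μ : Cardinal.{u}) : Prop where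
  two_le : 2 ≤ μ
  op_le : Cardinal.mk V.Op ≤ μ
  pow_eq : ∀ ι, 0 < ι → ι < V.lam → μ ^ ι = μ

namespace IsLarge

variable {V : Variety.{u}} {μ : Cardinal.{u}}

/-- Otherwise `ι = μ` would be an admissible exponent, and `μ ^ μ = μ` contradicts Cantor's theorem.
-/
theorem lam_le (h : IsLarge V μ) : V.lam ≤ μ := by
  by_contra! hlt
  have hpos : 0 < μ := two_pos.trans_le h.two_le
  have h₁ := h.pow_eq μ hpos hlt
  have h₂ : (2 : Cardinal) ^ μ ≤ μ ^ μ := Cardinal.power_le_power_right h.two_le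
  exact (Cardinal.cantor μ).not_ge (h₂.trans h₁.le)

theorem aleph0_le (h : IsLarge V μ) : Cardinal.aleph0 ≤ μ := V.lam_regular.aleph0_le.trans h.lam_le

theorem pow_le (h : IsLarge V μ) {ι : Cardinal.{u}} (hι : ι < V.lam) : μ ^ ι ≤ μ := by
  rcases eq_or_ne ι 0 with rfl | h0
  · rw [Cardinal.power_zero]
    exact Cardinal.one_le_aleph0.trans h.aleph0_le
  · exact (h.pow_eq ι (pos_iff_ne_zero.2 h0) hι).le

theorem term_le (h : IsLarge V μ) {X : Type u} (hX : Cardinal.mk X ≤ μ) :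
    Cardinal.mk (AlgTerm V.Ar X) ≤ μ :=
  AlgTerm.mk_le h.aleph0_le h.op_le hX fun α => h.pow_le (V.ar_lt α)

end IsLarge

end Cardinals

/-! ### Small subcoalgebras -/

section Subcoalgebras

/-- The algebra structure on a type that is embedded in an algebra, with closed image. -/
noncomputable def Alg.ofInjective {V : Variety.{u}} (R : Alg V) {T : Type u} (j : T → R.carrier)
    (hj : Function.Injective j) (hcl : ∀ α (x : V.Ar α → T), ∃ t, j t = R.op α fun i => j (x i)) :
    Alg V where
  carrier := T
  op α x := (hcl α x).choose
  sat e x := by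
    apply hj
    rw [AlgTerm.map_eval j (fun α x => (hcl α x).choose_spec),
      AlgTerm.map_eval j (fun α x => (hcl α x).choose_spec)]
    exact R.sat e _

variable {C D : Variety.{u}}

/-- The homomorphism that belongs to `Alg.ofInjective`. -/
noncomputable def Alg.ofInjectiveHom {V : Variety.{u}} (R : Alg V) {T : Type u}
    (j : T → R.carrier) (hj : Function.Injective j)
    (hcl : ∀ α (x : V.Ar α → T), ∃ t, j t = R.op α fun i => j (x i)) :
    R.ofInjective j hj hcl ⟶ R where
  toFun := j
  map_op α x := (hcl α x).choose_spec

/-- The factorization of a homomorphism through an injective homomorphism. -/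
noncomputable def Alg.factor {V : Variety.{u}} {X Y Z : Alg V} (f : X ⟶ Z) (m : Y ⟶ Z)
    (hm : Function.Injective m.toFun) (h : ∀ x, ∃ y, m.toFun y = f.toFun x) : X ⟶ Y where
  toFun x := (h x).choose
  map_op α x := by
    apply hm
    rw [(h _).choose_spec, f.map_op, m.map_op]
    congr 1
    funext i
    exact (h (x i)).choose_spec.symm

theorem Alg.factor_comp {V : Variety.{u}} {X Y Z : Alg V} (f : X ⟶ Z) (m : Y ⟶ Z)
    (hm : Function.Injective m.toFun) (h : ∀ x, ∃ y, m.toFun y = f.toFun x) :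
    Alg.factor f m hm h ≫ m = f := by
  ext x
  exact (h x).choose_spec

theorem Alg.cancel {V : Variety.{u}} {X Y Z : Alg V} {f g : X ⟶ Y} {m : Y ⟶ Z}
    (hm : Function.Injective m.toFun) (h : f ≫ m = g ≫ m) : f = g := by
  ext x
  exact hm (congrArg (fun k => Alg.Hom.toFun k x) h)

/-- Co-operations that are compatible with a morphism to a coalgebra which is injective on
copowers satisfy the identities. -/
theorem cosat_of_injective {R : Coalg (Alg C) D} {Q : Alg C}
    {co : (α : D.Op) → (Q ⟶ ∐ fun _ : D.Ar α => Q)} {m : Q ⟶ R.obj}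
    (hm : ∀ I : Type u, Function.Injective (Limits.Sigma.map fun _ : I => m).toFun)
    (hco : ∀ α, co α ≫ Limits.Sigma.map (fun _ : D.Ar α => m) = m ≫ R.co α) (B : Alg C) :
    D.Satisfies (homOp co B) := by
  refine satisfies_homOp_of_coproj (fun e => ?_) B
  -- After composition with the injective map to the copower of `R`, both sides become `m` followed
  -- by the two sides of an identity that holds for `R`.
  apply Alg.cancel (hm (D.Vars e))
  rw [eval_homOp_comp, eval_homOp_comp]
  simp only [Limits.Sigma.ι_map]
  rw [← comp_eval_homOp hco, ← comp_eval_homOp hco, R.cosat]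

/-- A coalgebra whose underlying set is a subset of `M`. -/
structure SmallCoalg (M : Type u) (C D : Variety.{u}) : Type u where
  /-- the underlying set -/
  s : Set M
  /-- the operations -/
  op : (α : C.Op) → (C.Ar α → s) → s
  sat : C.Satisfies op
  /-- the co-operations -/
  co : (α : D.Op) → ((⟨s, op, sat⟩ : Alg C) ⟶ ∐ fun _ : D.Ar α => (⟨s, op, sat⟩ : Alg C))
  cosat : ∀ B : Alg C, D.Satisfies (homOp co B)

/-- The coalgebra of a `SmallCoalg`. -/
def SmallCoalg.coalg {M : Type u} (P : SmallCoalg M C D) : Coalg (Alg C) D where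
  obj := ⟨P.s, P.op, P.sat⟩
  co := P.co
  cosat := P.cosat

/-- A morphism of coalgebras that is injective on all copowers. -/
def IsPure {Q R : Coalg (Alg C) D} (m : Q ⟶ R) : Prop :=
  ∀ I : Type u, Function.Injective (Limits.Sigma.map fun _ : I => m.hom).toFun

theorem injective_of_sigmaMap {Q R : Alg C} {m : Q ⟶ R}
    (hm : ∀ I : Type u, Function.Injective (Limits.Sigma.map fun _ : I => m).toFun) :
    Function.Injective m.toFun := by
  apply injective_of_copMap (I := PUnit.{u + 1}) PUnit.unit
  intro a b h
  apply Alg.iso_injective (copIso _ Q)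
  apply hm PUnit.{u + 1}
  rw [← copMap_copIso_apply, ← copMap_copIso_apply, h]

theorem IsPure.injective {Q R : Coalg (Alg C) D} {m : Q ⟶ R} (hm : IsPure m) :
    Function.Injective m.hom.toFun :=
  injective_of_sigmaMap hm

/-- A morphism whose image is contained in that of a pure morphism factors through it. -/
theorem IsPure.exists_factor {P Q R : Coalg (Alg C) D} {m : Q ⟶ R} (hm : IsPure m) (f : P ⟶ R)
    (h : Set.range f.hom.toFun ⊆ Set.range m.hom.toFun) : ∃ g : P ⟶ Q, g ≫ m = f := by
  obtain ⟨g, hg⟩ : ∃ g, g ≫ m.hom = f.hom :=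
    ⟨_, Alg.factor_comp f.hom m.hom hm.injective fun x => h ⟨x, rfl⟩⟩
  refine ⟨⟨g, fun α => ?_⟩, Coalg.hom_ext hg⟩
  -- Purity on the copower indexed by `D.Ar α` makes the factored homomorphism respect `α`.
  apply Alg.cancel (hm _)
  rw [Category.assoc, ← sigmaMap_comp, Category.assoc, m.comm, hg, ← Category.assoc, hg, f.comm]

/-- A set that is closed under the operations, contains the elements involved in the values of the
co-operations and is pure. -/
theorem exists_good_subset {μ : Cardinal.{u}} (hμ : IsLarge C μ) (hD : Cardinal.mk D.Op ≤ μ)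
    (R : Coalg (Alg C) D) (X : Set R.obj.carrier)
    (hX : Cardinal.mk X ≤ μ) :
    ∃ Q : Set R.obj.carrier, X ⊆ Q ∧ Cardinal.mk Q ≤ μ ∧
      (∀ α (x : C.Ar α → R.obj.carrier), (∀ i, x i ∈ Q) → R.obj.op α x ∈ Q) ∧
      ∀ (B : Alg C) (m : B ⟶ R.obj), Function.Injective m.toFun → Set.range m.toFun = Q →
        (∀ I : Type u, Function.Injective (Limits.Sigma.map fun _ : I => m).toFun) ∧
        ∀ (α : D.Op) (b : B.carrier), ∃ z,
          (Limits.Sigma.map fun _ : D.Ar α => m).toFun z = (R.co α).toFun (m.toFun b) := by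
  classical
  -- By `copMap_injective_of_large`, injectivity on the `K`-copower gives injectivity on all
  -- copowers.
  let K : Type u := C.lam.out
  have hK : Cardinal.mk K = C.lam := Cardinal.mk_out _
  have hω := hμ.aleph0_le
  choose SA hSA hSA' using fun (α : D.Op) (r : R.obj.carrier) =>
    exists_support ((R.co α).toFun r)
  -- The support is the empty set for unrelated pairs, so that `SB` is defined on all pairs of
  -- terms.
  have hB : ∀ p : AlgTerm C.Ar (Σ _ : K, R.obj.carrier) × AlgTerm C.Ar (Σ _ : K, R.obj.carrier),
      ∃ S : Set R.obj.carrier, Cardinal.mk S < C.lam ∧ (CoprodRel (fun _ : K => R.obj) p.1 p.2 →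
        ∀ (Q : Alg C) (m : Q ⟶ R.obj), Function.Injective m.toFun → S ⊆ Set.range m.toFun →
        ∃ s' t' : AlgTerm C.Ar (Σ _ : K, Q.carrier), s'.map (genMap K m) = p.1 ∧
          t'.map (genMap K m) = p.2 ∧ CoprodRel (fun _ : K => Q) s' t') := by
    intro p
    by_cases h : CoprodRel (fun _ : K => R.obj) p.1 p.2
    · obtain ⟨S, hS, h'⟩ := exists_support_rel h
      exact ⟨S, hS, fun _ => h'⟩
    · exact ⟨∅, by simpa using C.lam_regular.pos, fun h' => (h h').elim⟩
  choose SB hSB hSB' using hB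
  let lift (Y : Set R.obj.carrier) (t : AlgTerm C.Ar (Σ _ : K, Y)) :
      AlgTerm C.Ar (Σ _ : K, R.obj.carrier) := t.map fun p => ⟨p.1, p.2.1⟩
  -- Three closures: `ΦO` yields a subalgebra, `ΦA` lets the values of the co-operations come from
  -- its copowers, and `ΦB` yields purity.
  let ΦO (Y : Set R.obj.carrier) : Set R.obj.carrier :=
    ⋃ α, Set.range fun x : C.Ar α → Y => R.obj.op α fun i => (x i).1
  let ΦA (Y : Set R.obj.carrier) : Set R.obj.carrier := ⋃ p : D.Op × Y, SA p.1 p.2.1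
  let ΦB (Y : Set R.obj.carrier) : Set R.obj.carrier :=
    ⋃ p : AlgTerm C.Ar (Σ _ : K, Y) × AlgTerm C.Ar (Σ _ : K, Y), SB (lift Y p.1, lift Y p.2)
  have hprod : ∀ S T : Type u, Cardinal.mk S ≤ μ → Cardinal.mk T ≤ μ →
      Cardinal.mk (S × T) ≤ μ := by
    intro S T hS hT
    rw [Cardinal.mk_prod, Cardinal.lift_id, Cardinal.lift_id]
    exact (mul_le_mul' hS hT).trans (Cardinal.mul_eq_self hω).le
  have hunion : ∀ S T : Set R.obj.carrier, Cardinal.mk S ≤ μ → Cardinal.mk T ≤ μ →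
      Cardinal.mk (S ∪ T : Set _) ≤ μ := fun S T hS hT =>
    (Cardinal.mk_union_le S T).trans (Cardinal.add_le_of_le hω hS hT)
  have hterm : ∀ Y : Set R.obj.carrier, Cardinal.mk Y ≤ μ →
      Cardinal.mk (AlgTerm C.Ar (Σ _ : K, Y)) ≤ μ := by
    intro Y hY
    apply hμ.term_le
    rw [Cardinal.mk_congr (Equiv.sigmaEquivProd K Y)]
    exact hprod _ _ (hK.le.trans hμ.lam_le) hY
  obtain ⟨Q, hXQ, hQ, hcl⟩ := exists_closed C.lam_regular hμ.lam_le
    (fun Y : Set R.obj.carrier => Y ∪ (ΦO Y ∪ (ΦA Y ∪ ΦB Y))) (fun Y => Set.subset_union_left) (by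
      intro Y hY
      refine hunion _ _ hY (hunion _ _ ?_ (hunion _ _ ?_ ?_))
      · refine mk_iUnion_le_of_le hω hμ.op_le fun α => Cardinal.mk_range_le.trans ?_
        rw [← Cardinal.power_def]
        exact (Cardinal.power_le_power_right hY).trans (hμ.pow_le (C.ar_lt α))
      · exact mk_iUnion_le_of_le hω (hprod _ _ hD hY) fun p =>
          (hSA _ _).le.trans hμ.lam_le
      · exact mk_iUnion_le_of_le hω (hprod _ _ (hterm Y hY) (hterm Y hY)) fun p =>
          (hSB _).le.trans hμ.lam_le) X hX
  refine ⟨Q, hXQ, hQ, ?_, ?_⟩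
  · intro α x hx
    obtain ⟨Y, hY, hYQ⟩ := hcl (Set.range x) (Set.range_subset_iff.2 hx)
      (C.mk_range_lt x (C.ar_lt α))
    refine hYQ (Or.inr (Or.inl (Set.mem_iUnion.2 ⟨α, fun i => ⟨x i, hY ⟨i, rfl⟩⟩, rfl⟩)))
  · intro B m hm hmQ
    refine ⟨fun I => sigmaMap_injective (copMap_injective_of_large hK.ge ?_ I), ?_⟩
    · intro a b hab
      induction a using Quotient.ind with | _ s => ?_
      induction b using Quotient.ind with | _ t => ?_
      rw [copMap_mk, copMap_mk] at hab
      have hrel : CoprodRel (fun _ : K => R.obj) (s.map (genMap K m)) (t.map (genMap K m)) :=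
        Quotient.exact hab
      -- Both terms have few leaves, whose images lie in one set `Y` with `ΦB Y` contained in `Q`.
      -- Hence `Q` contains the support of a derivation of the relation, which can be lifted to `B`.
      obtain ⟨S, hS, s', rfl⟩ := C.exists_leaves s
      obtain ⟨T, hT, t', rfl⟩ := C.exists_leaves t
      let f : (Σ _ : K, B.carrier) → R.obj.carrier := fun p => m.toFun p.2
      obtain ⟨Y, hY, hYQ⟩ := hcl (f '' S ∪ f '' T)
        (by rintro _ (⟨p, -, rfl⟩ | ⟨p, -, rfl⟩) <;> exact hmQ ▸ ⟨p.2, rfl⟩)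
        (C.mk_union_lt (Cardinal.mk_image_le.trans_lt hS) (Cardinal.mk_image_le.trans_lt hT))
      let eS : S → Σ _ : K, Y := fun p => ⟨p.1.1, f p.1, hY (Or.inl ⟨p.1, p.2, rfl⟩)⟩
      let eT : T → Σ _ : K, Y := fun p => ⟨p.1.1, f p.1, hY (Or.inr ⟨p.1, p.2, rfl⟩)⟩
      have hs : lift Y (s'.map eS) = (s'.map Subtype.val).map (genMap K m) := by
        rw [AlgTerm.map_map]
        exact AlgTerm.map_map _ _ _
      have ht : lift Y (t'.map eT) = (t'.map Subtype.val).map (genMap K m) := by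
        rw [AlgTerm.map_map]
        exact AlgTerm.map_map _ _ _
      have hsub : SB (lift Y (s'.map eS), lift Y (t'.map eT)) ⊆ Set.range m.toFun := by
        refine hmQ ▸ Set.Subset.trans ?_ hYQ
        refine Set.Subset.trans ?_ (Set.subset_union_right.trans' (Set.subset_union_right.trans'
          Set.subset_union_right))
        exact Set.subset_iUnion (fun p : AlgTerm C.Ar (Σ _ : K, Y) × AlgTerm C.Ar (Σ _ : K, Y) =>
          SB (lift Y p.1, lift Y p.2)) (s'.map eS, t'.map eT)
      rw [hs, ht] at hsub
      obtain ⟨a, b, ha, hb, hr⟩ := hSB' _ hrel B m hm hsub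
      obtain rfl := AlgTerm.map_injective (genMap_injective hm) ha
      obtain rfl := AlgTerm.map_injective (genMap_injective hm) hb
      exact Quotient.sound hr
    · intro α b
      have hbQ : m.toFun b ∈ Q := hmQ ▸ ⟨b, rfl⟩
      obtain ⟨Y, hY, hYQ⟩ := hcl {m.toFun b} (Set.singleton_subset_iff.2 hbQ)
        (C.mk_singleton_lt _)
      refine hSA' α (m.toFun b) B m (hmQ ▸ Set.Subset.trans ?_ hYQ)
      refine Set.Subset.trans ?_ (Set.subset_union_right.trans' (Set.subset_union_right.trans'
        Set.subset_union_left))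
      exact Set.subset_iUnion (fun p : D.Op × Y => SA p.1 p.2.1) (α, ⟨m.toFun b, hY rfl⟩)

end Subcoalgebras

variable {C D : Variety.{u}} {μ : Cardinal.{u}}

/-- Every small set of elements of a coalgebra lies in a small pure subcoalgebra. -/
theorem exists_smallCoalg (hμ : IsLarge C μ) (hD : Cardinal.mk D.Op ≤ μ) {M : Type u}
    (hM : Cardinal.mk M = μ) (R : Coalg (Alg C) D) (X : Set R.obj.carrier)
    (hX : Cardinal.mk X ≤ μ) :
    ∃ (P : SmallCoalg M C D) (m : P.coalg ⟶ R), IsPure m ∧ X ⊆ Set.range m.hom.toFun := by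
  obtain ⟨Q, hXQ, hQ, hcl, hgood⟩ := exists_good_subset hμ hD R X hX
  -- The subcoalgebra is transported to a subset of `M`, so that all such coalgebras form a small
  -- type.
  obtain ⟨⟨j, hj⟩⟩ := Cardinal.le_def _ _ |>.1 (hQ.trans hM.ge)
  let e : Q ≃ Set.range j := Equiv.ofInjective j hj
  let k : Set.range j → R.obj.carrier := fun y => (e.symm y).1
  have hk : Function.Injective k := Subtype.val_injective.comp e.symm.injective
  have hkQ : Set.range k = Q := by
    rw [show k = Subtype.val ∘ e.symm from rfl, Set.range_comp, e.symm.surjective.range_eq,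
      Set.image_univ, Subtype.range_coe]
  have hkcl : ∀ α (x : C.Ar α → Set.range j), ∃ t, k t = R.obj.op α fun i => k (x i) := by
    intro α x
    have h : R.obj.op α (fun i => k (x i)) ∈ Set.range k := by
      rw [hkQ]
      exact hcl α _ fun i => (e.symm (x i)).2
    exact h
  let B := R.obj.ofInjective k hk hkcl
  let m : B ⟶ R.obj := R.obj.ofInjectiveHom k hk hkcl
  obtain ⟨hinj, hco⟩ := hgood B m hk hkQ
  let co (α : D.Op) : B ⟶ ∐ fun _ : D.Ar α => B :=
    Alg.factor (m ≫ R.co α) _ (hinj (D.Ar α)) fun b => hco α b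
  have hcomm : ∀ α, co α ≫ Limits.Sigma.map (fun _ : D.Ar α => m) = m ≫ R.co α :=
    fun α => Alg.factor_comp _ _ _ _
  exact ⟨⟨Set.range j, B.op, B.sat, co, cosat_of_injective hinj hcomm⟩, ⟨m, hcomm⟩, hinj,
    hXQ.trans hkQ.ge⟩

/-! ### A weakly terminal cone and the existence of limits -/

section WeaklyTerminal

variable (M : Type u) {E : Type u} [Category.{u} E] (F : E ⥤ Coalg (Alg C) D)

/-- The cones over `F` whose vertex is a coalgebra with underlying set contained in `M`. -/
structure SmallCone : Type u where
  /-- the vertex -/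
  pt : SmallCoalg M C D
  /-- the legs -/
  π : ∀ e, pt.coalg ⟶ F.obj e
  w : ∀ {e e' : E} (f : e ⟶ e'), π e ≫ F.map f = π e'

variable {M F} in
/-- Morphisms of cones. -/
@[ext]
structure SmallCone.Hom (x y : SmallCone M F) : Type u where
  /-- the morphism of vertices -/
  hom : x.pt.coalg ⟶ y.pt.coalg
  w : ∀ e, hom ≫ y.π e = x.π e

instance : Category (SmallCone M F) where
  Hom x y := SmallCone.Hom x y
  id x := ⟨𝟙 _, fun _ => Category.id_comp _⟩
  comp f g := ⟨f.hom ≫ g.hom, fun e => by rw [Category.assoc, g.w, f.w]⟩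
  id_comp _ := SmallCone.Hom.ext (Category.id_comp _)
  comp_id _ := SmallCone.Hom.ext (Category.comp_id _)
  assoc _ _ _ := SmallCone.Hom.ext (Category.assoc _ _ _)

/-- The functor that takes a small cone to its vertex. -/
def SmallCone.forget : SmallCone M F ⥤ Coalg (Alg C) D where
  obj x := x.pt.coalg
  map f := f.hom

/-- The colimit of the small cones. -/
noncomputable def colimitCone : Cone F where
  pt := colimit (SmallCone.forget M F)
  π :=
    { app := fun e => colimit.desc (SmallCone.forget M F)
        { pt := F.obj e
          ι :=
            { app := fun x => x.π e
              naturality := fun x y f => (f.w e).trans (Category.comp_id _).symm } }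
      naturality := fun e e' f => by
        apply colimit.hom_ext
        intro x
        refine (congrArg _ (Category.id_comp _)).trans ?_
        rw [← Category.assoc, colimit.ι_desc, colimit.ι_desc]
        exact (x.w f).symm }

variable {M F}

/-- The coprojections to the colimit of the small cones. -/
noncomputable def colimitConeι (x : SmallCone M F) : x.pt.coalg ⟶ (colimitCone M F).pt :=
  colimit.ι (SmallCone.forget M F) x

theorem colimitConeι_w {x y : SmallCone M F} (f : x ⟶ y) :
    f.hom ≫ colimitConeι y = colimitConeι x :=
  colimit.w (SmallCone.forget M F) f

theorem colimitConeι_π (x : SmallCone M F) (e : E) :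
    colimitConeι x ≫ (colimitCone M F).π.app e = x.π e :=
  colimit.ι_desc _ _

/-- The restriction of a cone to a small coalgebra. -/
def SmallCone.restrict (c : Cone F) {P : SmallCoalg M C D} (m : P.coalg ⟶ c.pt) :
    SmallCone M F :=
  ⟨P, fun e => m ≫ c.π.app e, fun f => by rw [Category.assoc, c.w]⟩

/-- The map from a small coalgebra over a cone to the colimit of the small cones. -/
noncomputable def restrictι (c : Cone F) {P : SmallCoalg M C D} (m : P.coalg ⟶ c.pt) :
    P.coalg ⟶ (colimitCone M F).pt :=
  colimitConeι (SmallCone.restrict c m)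

theorem restrictι_π (c : Cone F) {P : SmallCoalg M C D} (m : P.coalg ⟶ c.pt) (e : E) :
    restrictι c m ≫ (colimitCone M F).π.app e = m ≫ c.π.app e :=
  colimitConeι_π (SmallCone.restrict c m) e

theorem comp_restrictι (c : Cone F) {P Q : SmallCoalg M C D} {m : P.coalg ⟶ c.pt}
    {n : Q.coalg ⟶ c.pt} (g : P.coalg ⟶ Q.coalg) (hg : g ≫ n = m) :
    g ≫ restrictι c n = restrictι c m :=
  colimitConeι_w (x := SmallCone.restrict c m) (y := SmallCone.restrict c n)
    ⟨g, fun e => by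
      change g ≫ n ≫ _ = m ≫ _
      rw [← Category.assoc, hg]⟩

/-- The factorization of `m` through the pure `n` is a morphism of small cones, so the colimit
identifies the two values. This makes the map out of a cone well defined. -/
theorem restrictι_apply_eq (c : Cone F) {P Q : SmallCoalg M C D} {m : P.coalg ⟶ c.pt}
    {n : Q.coalg ⟶ c.pt} (hn : IsPure n)
    (h : Set.range m.hom.toFun ⊆ Set.range n.hom.toFun) {p : P.coalg.obj.carrier}
    {q : Q.coalg.obj.carrier} (hpq : m.hom.toFun p = n.hom.toFun q) :
    (restrictι c m).hom.toFun p = (restrictι c n).hom.toFun q := by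
  obtain ⟨g, hg⟩ := hn.exists_factor m h
  have hgp : g.hom.toFun p = q := by
    apply hn.injective
    rw [← hpq, ← hg]
    rfl
  rw [← comp_restrictι c g hg, ← hgp]
  rfl

theorem mk_range_le_of_smallCoalg (hM : Cardinal.mk M = μ) {P : SmallCoalg M C D} {X : Type u}
    (f : P.coalg.obj.carrier → X) : Cardinal.mk (Set.range f) ≤ μ :=
  Cardinal.mk_range_le.trans ((Cardinal.mk_set_le P.s).trans hM.le)

/-- Every cone over `F` maps to the colimit of the small cones. -/
theorem exists_hom_colimitCone (hμ : IsLarge C μ) (hD : Cardinal.mk D.Op ≤ μ)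
    (hM : Cardinal.mk M = μ) (c : Cone F) :
    ∃ h : c.pt ⟶ (colimitCone M F).pt, ∀ e, h ≫ (colimitCone M F).π.app e = c.π.app e := by
  have hω := hμ.aleph0_le
  have hone : ∀ r : c.pt.obj.carrier, ∃ (P : SmallCoalg M C D) (m : P.coalg ⟶ c.pt)
      (q : P.coalg.obj.carrier), IsPure m ∧ m.hom.toFun q = r := by
    intro r
    obtain ⟨P, m, hm, hr⟩ := exists_smallCoalg hμ hD hM c.pt {r} (by
      rw [Cardinal.mk_singleton]
      exact Cardinal.one_le_aleph0.trans hω)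
    obtain ⟨q, hq⟩ := hr rfl
    exact ⟨P, m, q, hm, hq⟩
  choose P m q hm hq using hone
  let h : c.pt.obj.carrier → (colimitCone M F).pt.obj.carrier :=
    fun r => (restrictι c (m r)).hom.toFun (q r)
  -- The value at an element does not depend on the small coalgebra chosen to reach it: `n` and the
  -- chosen morphism both factor through a third, pure one, and `n` itself need not be pure.
  have key : ∀ (Q : SmallCoalg M C D) (n : Q.coalg ⟶ c.pt) (a : Q.coalg.obj.carrier),
      h (n.hom.toFun a) = (restrictι c n).hom.toFun a := by
    intro Q n a
    obtain ⟨Q', n', hn', hr⟩ := exists_smallCoalg hμ hD hM c.pt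
      (Set.range n.hom.toFun ∪ Set.range (m (n.hom.toFun a)).hom.toFun)
      ((Cardinal.mk_union_le _ _).trans (Cardinal.add_le_of_le hω
        (mk_range_le_of_smallCoalg hM _) (mk_range_le_of_smallCoalg hM _)))
    obtain ⟨a', ha'⟩ := hr (Or.inl ⟨a, rfl⟩)
    rw [restrictι_apply_eq c hn' (Set.subset_union_left.trans hr) ha'.symm]
    exact restrictι_apply_eq c hn' (Set.subset_union_right.trans hr) ((hq _).trans ha'.symm)
  let hh : c.pt.obj ⟶ (colimitCone M F).pt.obj :=
    { toFun := h
      map_op := fun α x => by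
        -- The tuple has fewer than `C.lam ≤ μ` entries, so a single small subcoalgebra contains all
        -- of them.
        obtain ⟨Q, n, -, hr⟩ := exists_smallCoalg hμ hD hM c.pt (Set.range x)
          ((C.mk_range_lt x (C.ar_lt α)).le.trans hμ.lam_le)
        choose y hy using fun i => hr ⟨i, rfl⟩
        obtain rfl : (fun i => n.hom.toFun (y i)) = x := funext hy
        rw [← n.hom.map_op, key, (restrictι c n).hom.map_op]
        congr 1
        funext i
        exact (key Q n (y i)).symm }
  have hcomp : ∀ (Q : SmallCoalg M C D) (n : Q.coalg ⟶ c.pt),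
      n.hom ≫ hh = (restrictι c n).hom := fun Q n => Alg.hom_ext (key Q n)
  refine ⟨⟨hh, fun α => ?_⟩, fun e => ?_⟩
  · ext r
    obtain ⟨Q, n, a, rfl⟩ : ∃ (Q : SmallCoalg M C D) (n : Q.coalg ⟶ c.pt)
      (a : Q.coalg.obj.carrier), n.hom.toFun a = r := ⟨_, _, _, hq r⟩
    refine congrArg (fun k => Alg.Hom.toFun k a) (?_ : n.hom ≫ c.pt.co α ≫ _ = n.hom ≫ hh ≫ _)
    rw [← Category.assoc, ← n.comm, Category.assoc, ← sigmaMap_comp, ← Category.assoc, hcomp]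
    exact (restrictι c n).comm α
  · ext r
    obtain ⟨Q, n, a, rfl⟩ : ∃ (Q : SmallCoalg M C D) (n : Q.coalg ⟶ c.pt)
      (a : Q.coalg.obj.carrier), n.hom.toFun a = r := ⟨_, _, _, hq r⟩
    refine congrArg (fun k => Alg.Hom.toFun k a)
      (?_ : n.hom ≫ hh ≫ ((colimitCone M F).π.app e).hom = n.hom ≫ (c.π.app e).hom)
    rw [← Category.assoc, hcomp]
    exact congrArg Coalg.Hom.hom (restrictι_π c n e)

/-- The category of coalgebras has small limits. -/
theorem Coalg.hasLimits_of_isLarge (hμ : IsLarge C μ) (hD : Cardinal.mk D.Op ≤ μ) :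
    HasLimitsOfSize.{u, u} (Coalg (Alg C) D) where
  has_limits_of_shape E _ := by
    rw [hasLimitsOfShape_iff_isLeftAdjoint_const]
    have : PreservesLimitsOfSize.{u, u} (Functor.const E : Coalg (Alg C) D ⥤ _).op :=
      preservesLimitsOfSize_op _
    have : (Functor.const E : Coalg (Alg C) D ⥤ _).op.IsRightAdjoint := by
      apply isRightAdjoint_of_preservesLimits_of_solutionSetCondition
      intro F
      let c := colimitCone μ.out F.unop
      -- Weak terminality of `c` makes it a solution set with one element; uniqueness of the
      -- comparison morphism is not needed.
      refine ⟨PUnit, fun _ => Opposite.op c.pt, fun _ => Quiver.Hom.op c.π, fun X h => ?_⟩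
      obtain ⟨g, hg⟩ := exists_hom_colimitCone hμ hD (Cardinal.mk_out μ) ⟨X.unop, h.unop⟩
      refine ⟨⟨⟩, g.op, ?_⟩
      apply Quiver.Hom.unop_inj
      ext1
      ext1 e
      exact hg e
    exact (Adjunction.ofIsRightAdjoint
      (Functor.const E : Coalg (Alg C) D ⥤ _).op).unop.isLeftAdjoint

end WeaklyTerminal

/-! ### The bound on the cardinality of limits -/

section Cardinality

theorem isLarge_powMinus (C : Variety.{u}) (κ : Cardinal.{u}) (h₂ : 2 ≤ κ)
    (hκ : Cardinal.mk C.Op ≤ κ) : IsLarge C (powMinus κ C.lam) ∧ κ ≤ powMinus κ C.lam := by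
  have hne : {ν : Cardinal.{u} | κ ≤ ν ∧ ∀ ι, 0 < ι → ι < C.lam → ν ^ ι = ν}.Nonempty := by
    -- For nonzero `ι < C.lam` the infinite exponent `max κ C.lam` absorbs `ι`.
    refine ⟨2 ^ max κ C.lam, (le_max_left _ _).trans (Cardinal.cantor _).le, fun ι h₀ hι => ?_⟩
    rw [← Cardinal.power_mul, Cardinal.mul_eq_left
      (C.lam_regular.aleph0_le.trans (le_max_right _ _)) (hι.le.trans (le_max_right _ _)) h₀.ne']
  have h := csInf_mem hne
  exact ⟨⟨h₂.trans h.1, hκ.trans h.1, h.2⟩, h.1⟩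

variable {μ N : Cardinal.{u}}

theorem mk_pi_le {ι : Type u} {X : ι → Type u} (hN : ∀ κ ≤ μ, N ^ κ ≤ N)
    (hι : Cardinal.mk ι ≤ μ) (hX : ∀ i, Cardinal.mk (X i) ≤ N) :
    Cardinal.mk (∀ i, X i) ≤ N := by
  rw [Cardinal.mk_pi]
  refine (Cardinal.prod_le_prod _ _ hX).trans ?_
  rw [Cardinal.prod_const, Cardinal.lift_id, Cardinal.lift_id]
  exact hN _ hι

theorem mk_sigma_le {ι : Type u} {X : ι → Type u} (hN : Cardinal.aleph0 ≤ N)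
    (hι : Cardinal.mk ι ≤ N) (hX : ∀ i, Cardinal.mk (X i) ≤ N) :
    Cardinal.mk (Σ i, X i) ≤ N := by
  rw [Cardinal.mk_sigma]
  refine (Cardinal.sum_le_sum _ _ hX).trans ?_
  rw [Cardinal.sum_const']
  exact (mul_le_mul' hι le_rfl).trans (Cardinal.mul_eq_self hN).le

variable {C D : Variety.{u}}

theorem mk_hom_le {A B : Alg C} (hN : ∀ κ ≤ μ, N ^ κ ≤ N) (hA : Cardinal.mk A.carrier ≤ μ)
    (hB : Cardinal.mk B.carrier ≤ N) : Cardinal.mk (A ⟶ B) ≤ N :=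
  (Cardinal.mk_le_of_injective (f := fun k : A ⟶ B => k.toFun)
    fun _ _ h => Alg.Hom.ext h).trans (mk_pi_le hN hA fun _ => hB)

theorem mk_copower_le {I : Type u} {A : Alg C} (hN₀ : Cardinal.aleph0 ≤ N)
    (hN : ∀ κ < C.lam, N ^ κ ≤ N) (hOp : Cardinal.mk C.Op ≤ N) (hI : Cardinal.mk I ≤ N)
    (hA : Cardinal.mk A.carrier ≤ N) : Cardinal.mk (∐ fun _ : I => A).carrier ≤ N := by
  refine (Cardinal.mk_le_of_surjective (Alg.iso_surjective (copIso I A))).trans ?_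
  refine Cardinal.mk_quotient_le.trans ?_
  exact AlgTerm.mk_le hN₀ hOp (mk_sigma_le hN₀ hI fun _ => hA) fun α => hN _ (C.ar_lt α)

/-- The number of small coalgebras. -/
theorem mk_smallCoalg_le (hμ : IsLarge C μ) (hD : Cardinal.mk D.Op ≤ μ) {M : Type u}
    (hM : Cardinal.mk M = μ) (hN : ∀ κ ≤ μ, N ^ κ ≤ N) (hμN : 2 ^ μ ≤ N) (hlam : D.lam ≤ N) :
    Cardinal.mk (SmallCoalg M C D) ≤ N := by
  have hle : μ ≤ N := (Cardinal.cantor μ).le.trans hμN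
  have hω : Cardinal.aleph0 ≤ N := hμ.aleph0_le.trans hle
  have hs : ∀ s : Set M, Cardinal.mk s ≤ μ := fun s => (Cardinal.mk_set_le s).trans hM.le
  let T := Σ a : (Σ s : Set M, {op : (α : C.Op) → (C.Ar α → s) → s // C.Satisfies op}),
    ∀ α : D.Op, ((⟨a.1, a.2.1, a.2.2⟩ : Alg C) ⟶
      ∐ fun _ : D.Ar α => (⟨a.1, a.2.1, a.2.2⟩ : Alg C))
  let f : SmallCoalg M C D → T := fun P => ⟨⟨P.s, P.op, P.sat⟩, P.co⟩
  have hf : Function.Injective f := by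
    rintro ⟨s, op, sat, co, cosat⟩ ⟨s', op', sat', co', cosat'⟩ h
    obtain ⟨h, h'⟩ := Sigma.mk.inj h
    obtain ⟨rfl, h⟩ := Sigma.mk.inj h
    obtain rfl := Subtype.mk.inj (eq_of_heq h)
    obtain rfl := eq_of_heq h'
    rfl
  refine (Cardinal.mk_le_of_injective hf).trans (mk_sigma_le hω (mk_sigma_le hω ?_ ?_) ?_)
  · rw [Cardinal.mk_set, hM]
    exact hμN
  · intro s
    refine (Cardinal.mk_subtype_le _).trans (mk_pi_le hN hμ.op_le fun α => ?_)
    refine mk_pi_le hN ?_ fun _ => (hs s).trans hle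
    rw [← Cardinal.power_def]
    exact (Cardinal.power_le_power_right (hs s)).trans (hμ.pow_le (C.ar_lt α))
  · intro a
    -- The index set `D.Ar α` of the copower has fewer than `D.lam` elements; this is why `λ_D`
    -- occurs in the base of the bound.
    refine mk_pi_le hN hD fun α => mk_hom_le hN (hs a.1) (mk_copower_le hω
      (fun κ hκ => hN κ (hκ.le.trans hμ.lam_le)) (hμ.op_le.trans hle)
      ((D.ar_lt α).le.trans hlam) ((hs a.1).trans hle))

/-- The bound for the underlying set of a limit of coalgebras. -/
theorem mk_limit_le (hμ : IsLarge C μ) (hD : Cardinal.mk D.Op ≤ μ) {E : Type u} [Category.{u} E]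
    (F : E ⥤ Coalg (Alg C) D) (c : Cone F) (hc : IsLimit c) :
    Cardinal.mk c.pt.obj.carrier ≤
      (max (Cardinal.mk (limit (F ⋙ Coalg.forget (Alg C) D ⋙ Alg.forget C) : Type u)) D.lam) ^
        μ := by
  set L : Type u := limit (F ⋙ Coalg.forget (Alg C) D ⋙ Alg.forget C)
  set ν := max (Cardinal.mk L) D.lam
  -- The term `D.lam` also keeps the base infinite when `L` is small.
  have hν : Cardinal.aleph0 ≤ ν := D.lam_regular.aleph0_le.trans (le_max_right _ _)
  have hω := hμ.aleph0_le
  have hμ0 : μ ≠ 0 := (Cardinal.aleph0_pos.trans_le hω).ne'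
  have hμN : 2 ^ μ ≤ ν ^ μ :=
    Cardinal.power_le_power_right (((Cardinal.natCast_le_aleph0 (n := 2))).trans hν)
  have hνN : ν ≤ ν ^ μ := Cardinal.self_le_power ν (Cardinal.one_le_aleph0.trans hω)
  have hN₀ : Cardinal.aleph0 ≤ ν ^ μ := hν.trans hνN
  have hN : ∀ κ ≤ μ, (ν ^ μ) ^ κ ≤ ν ^ μ := by
    intro κ hκ
    rw [← Cardinal.power_mul]
    refine Cardinal.power_le_power_left (Cardinal.aleph0_pos.trans_le hν).ne' ?_
    exact (mul_le_mul' le_rfl hκ).trans (Cardinal.mul_eq_self hω).le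
  let M : Type u := μ.out
  have hM : Cardinal.mk M = μ := Cardinal.mk_out μ
  have hone : ∀ r : c.pt.obj.carrier, ∃ (P : SmallCoalg M C D) (m : P.coalg ⟶ c.pt)
      (q : P.s), m.hom.toFun q = r := by
    intro r
    obtain ⟨P, m, hm, hr⟩ := exists_smallCoalg hμ hD hM c.pt {r} (by
      rw [Cardinal.mk_singleton]
      exact Cardinal.one_le_aleph0.trans hω)
    obtain ⟨q, hq⟩ := hr rfl
    exact ⟨P, m, q, hq⟩
  choose P m q hq using hone
  let s : Cone (F ⋙ Coalg.forget (Alg C) D ⋙ Alg.forget C) :=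
    (Coalg.forget (Alg C) D ⋙ Alg.forget C).mapCone c
  let l : c.pt.obj.carrier → L := fun r => limit.lift _ s r
  have hl : ∀ a b, l a = l b → ∀ e, (c.π.app e).hom.toFun a = (c.π.app e).hom.toFun b := by
    intro a b hab e
    have h : ∀ r, limit.π (F ⋙ Coalg.forget (Alg C) D ⋙ Alg.forget C) e (l r) =
      (c.π.app e).hom.toFun r := fun r => limit.lift_π_apply s e r
    rw [← h a, ← h b, hab]
  -- An element is encoded by a small coalgebra, a point of it that maps to the element, and the
  -- trace in `L` of the morphism to the limit. The comparison map `l` itself need not be injective.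
  let f : c.pt.obj.carrier → Σ Q : SmallCoalg M C D, Q.s × (Q.s → L) :=
    fun r => ⟨P r, q r, fun x => l ((m r).hom.toFun x)⟩
  have hf : Function.Injective f := by
    have key : ∀ (Q Q' : SmallCoalg M C D) (n : Q.coalg ⟶ c.pt) (n' : Q'.coalg ⟶ c.pt)
        (a : Q.s) (a' : Q'.s),
        (⟨Q, a, fun x => l (n.hom.toFun x)⟩ : Σ Q : SmallCoalg M C D, Q.s × (Q.s → L)) =
          ⟨Q', a', fun x => l (n'.hom.toFun x)⟩ → n.hom.toFun a = n'.hom.toFun a' := by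
      intro Q Q' n n' a a' h
      obtain ⟨h₀, h⟩ := Sigma.mk.inj h
      subst h₀
      obtain ⟨rfl, h'⟩ := Prod.mk.inj (eq_of_heq h)
      -- The trace in `L` determines the composites with all legs, and a morphism into a limit is
      -- determined by these.
      have hn : n = n' := hc.hom_ext fun e => Coalg.hom_ext (Alg.hom_ext fun x =>
        hl _ _ (congrFun h' x) e)
      rw [hn]
    intro r r' h
    rw [← hq r, ← hq r']
    exact key _ _ _ _ _ _ h
  refine (Cardinal.mk_le_of_injective hf).trans (mk_sigma_le hN₀
    (mk_smallCoalg_le hμ hD hM hN hμN ((le_max_right _ _).trans hνN)) fun Q => ?_)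
  have hQ : Cardinal.mk Q.s ≤ μ := (Cardinal.mk_set_le Q.s).trans hM.le
  rw [Cardinal.mk_prod, Cardinal.lift_id, Cardinal.lift_id]
  refine (mul_le_mul' (hQ.trans ((Cardinal.cantor μ).le.trans hμN))
    (mk_pi_le hN hQ fun _ => (le_max_left _ _).trans hνN)).trans (Cardinal.mul_eq_self hN₀).le

end Cardinality

end UnivAlg

theorem theoremT (C D : UnivAlg.Variety.{u}) :
    -- the category of `D`-coalgebras in `C` has small limits
    HasLimitsOfSize.{u, u} (UnivAlg.Coalg (UnivAlg.Alg C) D) ∧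
    -- the category of representable functors from `C` to `D` is equivalent to its opposite
    (∃ e : (UnivAlg.Coalg (UnivAlg.Alg C) D)ᵒᵖ ≌ UnivAlg.Rep (UnivAlg.Alg C) D,
      Nonempty (e.functor ⋙ UnivAlg.IsRep.ι ≅ UnivAlg.Coalg.corep (UnivAlg.Alg C) D)) ∧
    -- and has small colimits; in particular, an initial object
    HasColimitsOfSize.{u, u} (UnivAlg.Rep (UnivAlg.Alg C) D) ∧
    HasInitial (UnivAlg.Rep (UnivAlg.Alg C) D) ∧
    -- the cardinality of the limit of a small diagram of coalgebras is bounded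
    ∀ (E : Type u) [Category.{u} E] (F : E ⥤ UnivAlg.Coalg (UnivAlg.Alg C) D)
      (c : Cone F), IsLimit c →
      Cardinal.mk c.pt.obj.carrier ≤
        (max (Cardinal.mk
            (limit (F ⋙ UnivAlg.Coalg.forget (UnivAlg.Alg C) D ⋙ UnivAlg.Alg.forget C) : Type u))
          D.lam) ^
        (UnivAlg.powMinus (max (max (Cardinal.mk C.Op) (Cardinal.mk D.Op)) 2) C.lam) := by
  obtain ⟨hμ, hle⟩ := UnivAlg.isLarge_powMinus C (max (max (Cardinal.mk C.Op) (Cardinal.mk D.Op)) 2)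
    (le_max_right _ _) ((le_max_left _ _).trans (le_max_left _ _))
  have hD := ((le_max_right (Cardinal.mk C.Op) (Cardinal.mk D.Op)).trans
    (le_max_left _ 2)).trans hle
  have hlim : HasLimitsOfSize.{u, u} (UnivAlg.Coalg (UnivAlg.Alg C) D) :=
    UnivAlg.Coalg.hasLimits_of_isLarge hμ hD
  have hcol : HasColimitsOfSize.{u, u} (UnivAlg.Rep (UnivAlg.Alg C) D) :=
    Adjunction.has_colimits_of_equivalence (UnivAlg.toRep (UnivAlg.Alg C) D).asEquivalence.inverse
  -- The initial object is a colimit over an empty shape in universe zero.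
  have hcol₀ : HasColimitsOfSize.{0, 0} (UnivAlg.Rep (UnivAlg.Alg C) D) :=
    hasColimitsOfSizeShrink.{0, 0, u, u} _
  exact ⟨hlim, ⟨(UnivAlg.toRep (UnivAlg.Alg C) D).asEquivalence, ⟨Iso.refl _⟩⟩, hcol,
    inferInstance,
    fun E _ F c hc => UnivAlg.mk_limit_le hμ hD F c hc⟩
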